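/- **Setting.** Let $\Lambda$ be a compact, path-connected metric space, $d\in\mathbb N$, and let $\mathbb A\colon\Lambda\times\mathbb Z\to\mathcal L(\mathbb R^d)$, $\mathbb A_n(\lambda)=\mathbb A(\lambda,n)$, be a parametrized linear discrete vector field, i.e. the family of maps $\mathbb A_n\colon\Lambda\to\mathcal L(\mathbb R^d)$, $n\in\mathbb Z$, is equicontinuous and pointwise bounded. For $k\ge n$ put $\Phi_\lambda(k,n)=\mathbb A_{k-1}(\lambda)\cdots\mathbb A_n(\lambda)$ and $\Phi_\lambda(n,n)=I_d$. For an integer $\kappa$ let $\mathbb Z^+_\kappa=\mathbb Z\cap[\kappa,\infty)$ and $\mathbb Z^-_\kappa=\mathbb Z\cap(-\infty,\kappa]$, and let $\mathbb I$ denote one of these intervals. We say that $\mathbb A$ has an exponential dichotomy on $\mathbb I$ with projector $\mathbb P\colon\Lambda\times\mathbb I\to\mathcal L(\mathbb R^d)$ if $\lambda\mapsto\mathbb P(\lambda,n)$ is continuous for every $n\in\mathbb I$ and there are $K\ge1$ and $\alpha\in(0,1)$ such that for every $\lambda\in\Lambda$: * $\mathbb P(\lambda,n)^2=\mathbb P(\lambda,n)$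 for all $n\in\mathbb I$, and $\sup_{n\in\mathbb I}\|\mathbb P(\lambda,n)\|<\infty$; * if $n,n+1\in\mathbb I$, then $\mathbb P(\lambda,n+1)\mathbb A_n(\lambda)=\mathbb A_n(\lambda)\mathbb P(\lambda,n)$, and $\mathbb A_n(\lambda)$ restricts to an isomorphism $\ker\mathbb P(\lambda,n)\to\ker\mathbb P(\lambda,n+1)$; * for all $k\ge n$ in $\mathbb I$ and $x\in\mathbb R^d$, $$|\Phi_\lambda(k,n)\mathbb P(\lambda,n)x|\le K\alpha^{k-n}|\mathbb P(\lambda,n)x|,\qquad |\Phi_\lambda(k,n)(I_d-\mathbb P(\lambda,n))x|\ge \tfrac1K\,\alpha^{-(k-n)}\,|(I_d-\mathbb P(\lambda,n))x|.$$ Let $\ell_0(\mathbb R^d)$ be the Banach space of sequences $\phi\colon\mathbb Z\to\mathbb R^d$ with $\phi(n)\to0$ as $n\to\pm\infty$, with the supremum norm, and let $L_{\mathbb A}(\lambda)\in\mathcal L(\ell_0(\mathbb R^d))$ be given by $(L_{\mathbb A}(\lambda)\phi)(n)=\phi(n+1)-\mathbb A_n(\lambda)\phi(n)$. $KO(\Lambda)$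 is the Grothendieck group of the monoid of isomorphism classes of finite-rank real vector bundles over $\Lambda$ under direct sum. Let $L\colon\Lambda\to\mathcal L(X,Y)$ be a continuous family of Fredholm operators between Banach spaces. Its index bundle is $$\operatorname{ind}(L)=[E(L,V)]-[\Lambda\times V]\in KO(\Lambda),\qquad E(L,V)=\{(\lambda,x)\in\Lambda\times X\mid L(\lambda)x\in V\},$$ where $V\subset Y$ is any finite-dimensional subspace with $\operatorname{im}L(\lambda)+V=Y$ for all $\lambda\in\Lambda$. Such $V$ exist. **Theorem.** Let $\underline\kappa<0<\overline\kappa$ be integers, and suppose that $\mathbb A$ has an exponential dichotomy on $\mathbb Z^+_{\overline\kappa}$ with projector $\mathbb P^+$ and an exponential dichotomy on $\mathbb Z^-_{\underline\kappa}$ with projector $\mathbb P^-$. Then: (a) $L_{\mathbb A}\colon\Lambda\to\mathcal L(\ell_0(\mathbb R^d))$ is a norm-continuous family of Fredholm operators. (b) The index bundle of $L_{\mathbb A}$, computed with any transversal subspace $V$ as above, is $$\operatorname{ind}(L_{\mathbb A})=[\operatorname{Im}\mathbb P^+(\overline\kappa)]-[\operatorname{Im}\mathbb P^-(\underline\kappa)]\in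 KO(\Lambda),$$ where $\operatorname{Im}\mathbb P^+(\overline\kappa)=\{(\lambda,x)\in\Lambda\times\mathbb R^d\mid x\in\operatorname{im}\mathbb P^+(\lambda,\overline\kappa)\}$, and similarly $\operatorname{Im}\mathbb P^-(\underline\kappa)$, are vector bundles over $\Lambda$. -/

import Mathlib

open Bundle Topology Set
open scoped ZeroAtInfty
universe u

noncomputable section

/-- A real vector bundle of finite constant rank over `B`: Mathlib's `VectorBundle`, bundled with
its model fibre, its fibres and the topology of its total space. (Over a connected base every real
vector bundle of finite rank has constant rank.) -/
structure RealVectorBundle (B : Type u) [TopologicalSpace B] where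
  Model : Type
  [modelGroup : NormedAddCommGroup Model]
  [modelSpace : NormedSpace ℝ Model]
  [modelFinite : FiniteDimensional ℝ Model]
  Fiber : B → Type
  [fiberGroup : ∀ x, AddCommGroup (Fiber x)]
  [fiberModule : ∀ x, Module ℝ (Fiber x)]
  [fiberTop : ∀ x, TopologicalSpace (Fiber x)]
  [totalTop : TopologicalSpace (TotalSpace Model Fiber)]
  [fiberBundle : FiberBundle Model Fiber]
  [vectorBundle : VectorBundle ℝ Model Fiber]

namespace RealVectorBundle

attribute [instance] modelGroup modelSpace modelFinite fiberGroup fiberModule fiberTop totalTop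
  fiberBundle vectorBundle

variable {B : Type u} [TopologicalSpace B]

/-- The total space of a bundle. -/
abbrev Total (E : RealVectorBundle B) : Type u := TotalSpace E.Model E.Fiber

/-- `E ≅ F`: there is a homeomorphism of the total spaces over the identity of the base which is
linear on the fibres. -/
def IsIso (E F : RealVectorBundle B) : Prop :=
  ∃ φ : ∀ x, E.Fiber x ≃ₗ[ℝ] F.Fiber x,
    Continuous (fun p : E.Total => (⟨p.1, φ p.1 p.2⟩ : F.Total)) ∧
    Continuous (fun p : F.Total => (⟨p.1, (φ p.1).symm p.2⟩ : E.Total))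

theorem IsIso.refl (E : RealVectorBundle B) : E.IsIso E :=
  ⟨fun _ => LinearEquiv.refl ℝ _, continuous_id, continuous_id⟩

theorem IsIso.symm {E F : RealVectorBundle B} (h : E.IsIso F) : F.IsIso E := by
  obtain ⟨φ, h1, h2⟩ := h
  exact ⟨fun x => (φ x).symm, h2, h1⟩

theorem IsIso.trans {E F G : RealVectorBundle B} (h : E.IsIso F) (h' : F.IsIso G) :
    E.IsIso G := by
  obtain ⟨φ, h1, h2⟩ := h
  obtain ⟨ψ, h3, h4⟩ := h'
  exact ⟨fun x => (φ x).trans (ψ x), h3.comp h1, h2.comp h4⟩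

/-- The Whitney (fibrewise direct) sum. -/
abbrev sum (E F : RealVectorBundle B) : RealVectorBundle B where
  Model := E.Model × F.Model
  Fiber := E.Fiber ×ᵇ F.Fiber

/-- The product bundle `Θ(V) = B × V`. -/
abbrev trivial (B : Type u) [TopologicalSpace B] (V : Type) [NormedAddCommGroup V] [NormedSpace ℝ V]
    [FiniteDimensional ℝ V] : RealVectorBundle B where
  Model := V
  Fiber := Bundle.Trivial B V

theorem continuous_sum_iff {Z : Type*} [TopologicalSpace Z] (E F : RealVectorBundle B)
    (f : Z → (E.sum F).Total) :
    Continuous f ↔ Continuous (fun z => (⟨(f z).1, (f z).2.1⟩ : E.Total)) ∧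
      Continuous (fun z => (⟨(f z).1, (f z).2.2⟩ : F.Total)) := by
  exact (FiberBundle.Prod.isInducing_diag E.Model E.Fiber F.Model F.Fiber).continuous_iff.trans
    continuous_prodMk

theorem continuous_sum_fst (E F : RealVectorBundle B) :
    Continuous (fun p : (E.sum F).Total => (⟨p.1, p.2.1⟩ : E.Total)) :=
  ((continuous_sum_iff E F id).1 continuous_id).1

theorem continuous_sum_snd (E F : RealVectorBundle B) :
    Continuous (fun p : (E.sum F).Total => (⟨p.1, p.2.2⟩ : F.Total)) :=
  ((continuous_sum_iff E F id).1 continuous_id).2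

theorem IsIso.sum {E E' F F' : RealVectorBundle B} (h : E.IsIso E') (h' : F.IsIso F') :
    (E.sum F).IsIso (E'.sum F') := by
  obtain ⟨φ, h1, h2⟩ := h
  obtain ⟨ψ, h3, h4⟩ := h'
  refine ⟨fun x => (φ x).prodCongr (ψ x), ?_, ?_⟩
  · exact (continuous_sum_iff _ _ _).2
      ⟨h1.comp (continuous_sum_fst E F), h3.comp (continuous_sum_snd E F)⟩
  · exact (continuous_sum_iff _ _ _).2
      ⟨h2.comp (continuous_sum_fst E' F'), h4.comp (continuous_sum_snd E' F')⟩

theorem sum_comm_iso (E F : RealVectorBundle B) : (E.sum F).IsIso (F.sum E) :=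
  ⟨fun _ => LinearEquiv.prodComm ℝ _ _,
    (continuous_sum_iff _ _ _).2 ⟨continuous_sum_snd E F, continuous_sum_fst E F⟩,
    (continuous_sum_iff _ _ _).2 ⟨continuous_sum_snd F E, continuous_sum_fst F E⟩⟩

theorem sum_assoc_iso (E F G : RealVectorBundle B) :
    ((E.sum F).sum G).IsIso (E.sum (F.sum G)) := by
  refine ⟨fun x => LinearEquiv.prodAssoc ℝ (E.Fiber x) (F.Fiber x) (G.Fiber x), ?_, ?_⟩
  · refine (continuous_sum_iff _ _ _).2 ⟨?_, (continuous_sum_iff _ _ _).2 ⟨?_, ?_⟩⟩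
    · exact (continuous_sum_fst E F).comp (continuous_sum_fst (E.sum F) G)
    · exact (continuous_sum_snd E F).comp (continuous_sum_fst (E.sum F) G)
    · exact continuous_sum_snd (E.sum F) G
  · refine (continuous_sum_iff _ _ _).2 ⟨(continuous_sum_iff _ _ _).2 ⟨?_, ?_⟩, ?_⟩
    · exact continuous_sum_fst E (F.sum G)
    · exact (continuous_sum_fst F G).comp (continuous_sum_snd E (F.sum G))
    · exact (continuous_sum_snd F G).comp (continuous_sum_snd E (F.sum G))

theorem zero_sum_iso (E : RealVectorBundle B) : ((trivial B PUnit).sum E).IsIso E := by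
  refine ⟨fun x => LinearEquiv.uniqueProd (R := ℝ) (M := E.Fiber x) (M₂ := PUnit), ?_, ?_⟩
  · exact continuous_sum_snd _ _
  · refine (continuous_sum_iff _ _ _).2 ⟨?_, continuous_id⟩
    refine (Bundle.Trivial.homeomorphProd B PUnit).isInducing.continuous_iff.2 ?_
    exact (FiberBundle.continuous_proj E.Model E.Fiber).prodMk continuous_const

/-- Isomorphism of vector bundles as an equivalence relation. -/
def isoSetoid (B : Type u) [TopologicalSpace B] : Setoid (RealVectorBundle B) where
  r := IsIso
  iseqv := ⟨IsIso.refl, IsIso.symm, IsIso.trans⟩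

end RealVectorBundle

/-- Isomorphism classes of real vector bundles. -/
def BundleClass (B : Type u) [TopologicalSpace B] : Type (max u 1) :=
  Quotient (RealVectorBundle.isoSetoid B)

instance BundleClass.instAdd (B : Type u) [TopologicalSpace B] : Add (BundleClass B) where
  add := Quotient.map₂ RealVectorBundle.sum fun _ _ h _ _ h' => h.sum h'

instance BundleClass.instZero (B : Type u) [TopologicalSpace B] : Zero (BundleClass B) where
  zero := Quotient.mk _ (RealVectorBundle.trivial B PUnit)

/-- The isomorphism classes form a commutative monoid under the Whitney sum. -/
instance BundleClass.instAddCommMonoid (B : Type u) [TopologicalSpace B] :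
    AddCommMonoid (BundleClass B) where
  add_assoc := by
    rintro ⟨E⟩ ⟨F⟩ ⟨G⟩
    exact Quotient.sound (RealVectorBundle.sum_assoc_iso E F G)
  zero_add := by
    rintro ⟨E⟩
    exact Quotient.sound (RealVectorBundle.zero_sum_iso E)
  add_zero := by
    rintro ⟨E⟩
    exact Quotient.sound ((RealVectorBundle.sum_comm_iso _ _).trans
      (RealVectorBundle.zero_sum_iso E))
  add_comm := by
    rintro ⟨E⟩ ⟨F⟩
    exact Quotient.sound (RealVectorBundle.sum_comm_iso E F)
  nsmul := nsmulRec

/-- `KO(B)`: the Grothendieck group of the monoid of isomorphism classes of real vector bundles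
over a (connected, compact) space `B`. -/
abbrev KO (B : Type u) [TopologicalSpace B] : Type (max u 1) :=
  Algebra.GrothendieckAddGroup (BundleClass B)

/-- The class `[E] ∈ KO(B)` of a bundle. -/
def RealVectorBundle.koClass {B : Type u} [TopologicalSpace B] (E : RealVectorBundle B) : KO B :=
  Algebra.GrothendieckAddGroup.of (Quotient.mk (RealVectorBundle.isoSetoid B) E : BundleClass B)

/-! ### Families of subspaces of a normed space -/

section Subbundle

variable {B : Type u} [TopologicalSpace B] {X : Type} [NormedAddCommGroup X] [NormedSpace ℝ X]

/-- The family of subspaces `S` is locally trivial with model `F`: near every point there are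
linear parametrizations `g x : F → S x`, continuous in `x`, with a common continuous linear
left inverse `q`. -/
def LocallyTrivialFamily (S : B → Submodule ℝ X) (F : Type) [NormedAddCommGroup F]
    [NormedSpace ℝ F] : Prop :=
  ∀ x₀, ∃ U : Set B, IsOpen U ∧ x₀ ∈ U ∧ ∃ (q : X →L[ℝ] F) (g : B → F →L[ℝ] X),
    ContinuousOn g U ∧ ∀ x ∈ U, (∀ w, g x w ∈ S x) ∧ (∀ w, q (g x w) = w) ∧
      ∀ v ∈ S x, g x (q v) = v

/-- The total space `{(x, v) | v ∈ S x}` carries the subspace topology of `B × X`. -/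
abbrev subspaceTopology (S : B → Submodule ℝ X) (F : Type) :
    TopologicalSpace (TotalSpace F (fun x => S x)) :=
  TopologicalSpace.induced (fun p => (p.1, (p.2 : X))) inferInstance

open Classical in
/-- The local trivialization of a family of subspaces given by `q` and `g`. -/
def subspaceTrivialization (S : B → Submodule ℝ X) (F : Type) [NormedAddCommGroup F]
    [NormedSpace ℝ F] (U : Set B) (hU : IsOpen U) (q : X →L[ℝ] F) (g : B → F →L[ℝ] X)
    (hg : ContinuousOn g U) (h : ∀ x ∈ U, (∀ w, g x w ∈ S x) ∧ (∀ w, q (g x w) = w) ∧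
      ∀ v ∈ S x, g x (q v) = v) :
    letI := subspaceTopology S F
    Trivialization F (π F (fun x => S x)) :=
  letI := subspaceTopology S F
  { toFun := fun p => (p.1, q (p.2 : X))
    invFun := fun p => ⟨p.1, if hp : p.1 ∈ U then ⟨g p.1 p.2, (h p.1 hp).1 p.2⟩ else 0⟩
    source := π F (fun x => S x) ⁻¹' U
    target := U ×ˢ univ
    map_source' := fun p hp => ⟨hp, mem_univ _⟩
    map_target' := fun p hp => hp.1
    left_inv' := by
      rintro ⟨x, v⟩ hx
      have hx' : x ∈ U := hx
      simp only [hx', dif_pos]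
      congr 1
      exact Subtype.ext ((h x hx').2.2 v v.2)
    right_inv' := by
      rintro ⟨x, w⟩ hx
      have hx' : x ∈ U := hx.1
      simp only [hx', dif_pos]
      exact Prod.ext rfl ((h x hx').2.1 w)
    open_source := hU.preimage (continuous_fst.comp continuous_induced_dom)
    open_target := hU.prod isOpen_univ
    continuousOn_toFun := by
      have h1 : Continuous (fun p : TotalSpace F (fun x => S x) => (p.1, (p.2 : X))) :=
        continuous_induced_dom
      exact ((continuous_fst.comp h1).prodMk (q.continuous.comp
        (continuous_snd.comp h1))).continuousOn
    continuousOn_invFun := by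
      refine (Topology.IsInducing.mk rfl : Topology.IsInducing
        (fun p : TotalSpace F (fun x => S x) => (p.1, (p.2 : X)))).continuousOn_iff.2 ?_
      have h1 : ContinuousOn (fun p : B × F => (p.1, g p.1 p.2)) (U ×ˢ univ) :=
        continuousOn_fst.prodMk
          ((hg.comp continuousOn_fst fun p hp => hp.1).clm_apply continuousOn_snd)
      refine h1.congr ?_
      rintro ⟨x, w⟩ hx
      have hx' : x ∈ U := hx.1
      simp [hx']
    baseSet := U
    open_baseSet := hU
    source_eq := rfl
    target_eq := rfl
    proj_toFun := fun p _ => rfl }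

theorem subspaceTrivialization_isLinear (S : B → Submodule ℝ X) (F : Type) [NormedAddCommGroup F]
    [NormedSpace ℝ F] (U : Set B) (hU : IsOpen U) (q : X →L[ℝ] F) (g : B → F →L[ℝ] X)
    (hg : ContinuousOn g U) (h : ∀ x ∈ U, (∀ w, g x w ∈ S x) ∧ (∀ w, q (g x w) = w) ∧
      ∀ v ∈ S x, g x (q v) = v) :
    let _ := subspaceTopology S F
    (subspaceTrivialization S F U hU q g hg h).IsLinear ℝ := by
  let _ := subspaceTopology S F
  exact ⟨fun x _ => ⟨fun v w => q.map_add v w, fun c v => q.map_smul c v⟩⟩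

theorem LocallyTrivialFamily.exists_trivialization {S : B → Submodule ℝ X} {F : Type}
    [NormedAddCommGroup F] [NormedSpace ℝ F] (hS : LocallyTrivialFamily S F) (x₀ : B) :
    letI := subspaceTopology S F
    ∃ e : Trivialization F (π F (fun x => S x)), e.IsLinear ℝ ∧ x₀ ∈ e.baseSet := by
  obtain ⟨U, hU, hx, q, g, hg, h⟩ := hS x₀
  exact ⟨subspaceTrivialization S F U hU q g hg h,
    subspaceTrivialization_isLinear S F U hU q g hg h, hx⟩

/-- The fibre bundle structure on a locally trivial family of subspaces; its atlas consists of all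
fibrewise linear local trivializations. -/
abbrev subspaceFiberBundle (S : B → Submodule ℝ X) (F : Type) [NormedAddCommGroup F]
    [NormedSpace ℝ F] (hS : LocallyTrivialFamily S F) :
    letI := subspaceTopology S F
    FiberBundle F (fun x => S x) :=
  letI := subspaceTopology S F
  { totalSpaceMk_isInducing' := fun b => by
      have h1 : Topology.IsInducing
          (fun p : TotalSpace F (fun x => S x) => (p.1, (p.2 : X))) := ⟨rfl⟩
      refine (Topology.IsInducing.of_comp_iff h1).1 ?_
      exact (_root_.isInducing_prodMkRight b).comp Topology.IsInducing.subtypeVal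
    trivializationAtlas' := {e | e.IsLinear ℝ}
    trivializationAt' := fun b => (hS.exists_trivialization b).choose
    mem_baseSet_trivializationAt' := fun b => (hS.exists_trivialization b).choose_spec.2
    trivialization_mem_atlas' := fun b => (hS.exists_trivialization b).choose_spec.1 }

theorem subspaceVectorBundle (S : B → Submodule ℝ X) (F : Type) [NormedAddCommGroup F]
    [NormedSpace ℝ F] [FiniteDimensional ℝ F] (hS : LocallyTrivialFamily S F) :
    letI := subspaceTopology S F
    letI := subspaceFiberBundle S F hS
    VectorBundle ℝ F (fun x => S x) := by
  let _ := subspaceTopology S F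
  let _ := subspaceFiberBundle S F hS
  refine ⟨fun e he => he.out, fun e e' he he' => ?_⟩
  have : e.IsLinear ℝ := he.out
  have : e'.IsLinear ℝ := he'.out
  rw [continuousOn_clm_apply]
  intro w
  have h1 : ContinuousOn (fun b => (e' (e.toOpenPartialHomeomorph.symm (b, w))).2)
      (e.baseSet ∩ e'.baseSet) := by
    refine continuous_snd.comp_continuousOn (e'.continuousOn.comp
      (e.toOpenPartialHomeomorph.continuousOn_symm.comp
        (continuousOn_id.prodMk continuousOn_const) ?_) ?_)
    · intro b hb
      exact e.mem_target.2 hb.1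
    · intro b hb
      change e.toOpenPartialHomeomorph.symm (b, w) ∈ e'.source
      rw [e'.mem_source, e.proj_symm_apply' hb.1]
      exact hb.2
  refine h1.congr fun b hb => ?_
  exact e.coordChangeL_apply' e' hb w

/-- The vector bundle `{(x, v) ∈ B × X | v ∈ S x}`, a subbundle of `B × X`. -/
abbrev subspaceBundle (S : B → Submodule ℝ X) (F : Type) [NormedAddCommGroup F]
    [NormedSpace ℝ F] [FiniteDimensional ℝ F] (hS : LocallyTrivialFamily S F) :
    RealVectorBundle B :=
  letI := subspaceTopology S F
  letI := subspaceFiberBundle S F hS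
  haveI := subspaceVectorBundle S F hS
  { Model := F
    Fiber := fun x => S x }

/-- Over a connected base it is enough to trivialize near each `x₀` with model `S x₀`. -/
theorem locallyTrivialFamily_of_local [PreconnectedSpace B] (S : B → Submodule ℝ X)
    [∀ x, FiniteDimensional ℝ (S x)]
    (h : ∀ x₀, ∃ U : Set B, IsOpen U ∧ x₀ ∈ U ∧ ∃ (q : X →L[ℝ] S x₀) (g : B → S x₀ →L[ℝ] X),
      ContinuousOn g U ∧ ∀ x ∈ U, (∀ w, g x w ∈ S x) ∧ (∀ w, q (g x w) = w) ∧
        ∀ v ∈ S x, g x (q v) = v) (b : B) :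
    LocallyTrivialFamily S (S b) := by
  have hdim : IsLocallyConstant (fun x => Module.finrank ℝ (S x)) := by
    rw [IsLocallyConstant.iff_exists_open]
    intro x₀
    obtain ⟨U, hU, hx, q, g, -, hqg⟩ := h x₀
    refine ⟨U, hU, hx, fun x hxU => ?_⟩
    obtain ⟨h1, h2, h3⟩ := hqg x hxU
    refine LinearEquiv.finrank_eq (LinearEquiv.ofLinearMap
      (q.toLinearMap.comp (S x).subtype)
      ((g x).toLinearMap.codRestrict (S x) h1) ?_ ?_)
    · ext w
      simp [h2]
    · ext v
      simp [h3 v v.2]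
  intro x₀
  obtain ⟨U, hU, hx, q, g, hg, hqg⟩ := h x₀
  let e : S x₀ ≃L[ℝ] S b :=
    ContinuousLinearEquiv.ofFinrankEq (hdim.apply_eq_of_preconnectedSpace x₀ b)
  refine ⟨U, hU, hx, (e : S x₀ →L[ℝ] S b) ∘L q, fun x => g x ∘L (e.symm : S b →L[ℝ] S x₀),
    ?_, fun x hxU => ?_⟩
  · exact hg.clm_comp continuousOn_const
  · obtain ⟨h1, h2, h3⟩ := hqg x hxU
    refine ⟨fun w => h1 _, fun w => ?_, fun v hv => ?_⟩
    · simp [h2]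
    · simp [h3 v hv]

end Subbundle

section Families

variable {B : Type u} [TopologicalSpace B]

theorem exists_local_inverse {X Z : Type*} [NormedAddCommGroup X] [NormedSpace ℝ X]
    [CompleteSpace X] [NormedAddCommGroup Z] [NormedSpace ℝ Z] [CompleteSpace Z]
    (T : B → X →L[ℝ] Z) (hT : Continuous T) (x₀ : B) (h₀ : Function.Bijective (T x₀)) :
    ∃ U : Set B, IsOpen U ∧ x₀ ∈ U ∧ ∃ R : B → Z →L[ℝ] X, ContinuousOn R U ∧
      ∀ x ∈ U, (∀ z, T x (R x z) = z) ∧ ∀ v, R x (T x v) = v := by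
  refine ⟨T ⁻¹' range ((↑) : (X ≃L[ℝ] Z) → X →L[ℝ] Z), ContinuousLinearEquiv.isOpen.preimage hT,
    ?_, fun x => (T x).inverse, ?_, ?_⟩
  · refine ⟨ContinuousLinearEquiv.ofBijective (T x₀) (LinearMap.ker_eq_bot.2 h₀.1)
      (LinearMap.range_eq_top.2 h₀.2), ?_⟩
    ext v
    rfl
  · rintro x ⟨e, he⟩
    have h1 : ContinuousAt ContinuousLinearMap.inverse (T x) := by
      rw [← he]
      exact (contDiffAt_map_inverse (n := 0) e).continuousAt
    exact (h1.comp hT.continuousAt).continuousWithinAt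
  · rintro x ⟨e, he⟩
    simp [← he]

/-- The image `Im P` of a continuous family of projections is locally trivial. -/
theorem locallyTrivialFamily_range [PreconnectedSpace B] {X : Type} [NormedAddCommGroup X]
    [NormedSpace ℝ X] [FiniteDimensional ℝ X] (P : B → X →L[ℝ] X) (hc : Continuous P)
    (hP : ∀ x, P x ∘L P x = P x) (b : B) :
    LocallyTrivialFamily (fun x => (P x).range) (P b).range := by
  have : CompleteSpace X := FiniteDimensional.complete ℝ X
  have hPP : ∀ x v, P x (P x v) = P x v := fun x v => congrArg (fun f => f v) (hP x)
  have hmem : ∀ x v, v ∈ (P x).range ↔ P x v = v := by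
    intro x v
    constructor
    · rintro ⟨w, rfl⟩
      exact hPP x w
    · intro h
      exact ⟨v, h⟩
  refine locallyTrivialFamily_of_local (fun x => (P x).range) (fun x₀ => ?_) b
  let I : X →L[ℝ] X := ContinuousLinearMap.id ℝ X
  let T : B → X →L[ℝ] X := fun x => P x₀ ∘L P x + (I - P x₀) ∘L (I - P x)
  have hT : Continuous T :=
    (continuous_const.clm_comp hc).add (continuous_const.clm_comp (continuous_const.sub hc))
  have hT₀ : T x₀ = I := by
    ext v
    simp [T, I, hPP]
  obtain ⟨U, hU, hx, R, hR, hinv⟩ := exists_local_inverse T hT x₀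
    (by rw [hT₀]; exact Function.bijective_id)
  refine ⟨U, hU, hx, (P x₀).codRestrict _ (fun v => ⟨v, rfl⟩),
    fun x => R x ∘L (P x₀).range.subtypeL, hR.clm_comp continuousOn_const, fun x hxU => ?_⟩
  obtain ⟨h1, h2⟩ := hinv x hxU
  have hTP : ∀ v, P x₀ (T x v) = P x₀ (P x v) := by
    intro v
    simp [T, I, hPP]
  have key : ∀ w, P x₀ w = w → P x (R x w) = R x w := by
    intro w hw
    have h3 : T x (P x (R x w)) = T x (R x w) := by
      have h4 : T x (P x (R x w)) = P x₀ (P x (R x w)) := by simp [T, I, hPP]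
      rw [h4, ← hTP, h1, hw]
    have h5 := congrArg (R x) h3
    rwa [h2, h2] at h5
  refine ⟨fun w => (hmem _ _).2 (key w ((hmem _ _).1 w.2)), fun w => ?_, fun v hv => ?_⟩
  · apply Subtype.ext
    have hw := (hmem _ _).1 w.2
    have h3 := hTP (R x w)
    rw [h1, hw, key w hw] at h3
    exact h3.symm
  · have h3 : T x v = P x₀ v := by
      have hv' := (hmem _ _).1 hv
      simp [T, I, hv']
    have h4 := h2 v
    rw [h3] at h4
    exact h4

/-- The vector bundle `Im P = {(x, v) | v ∈ im (P x)}` of a continuous family of projections. -/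
def imageBundle [ConnectedSpace B] {X : Type} [NormedAddCommGroup X]
    [NormedSpace ℝ X] [FiniteDimensional ℝ X] (P : B → X →L[ℝ] X) (hc : Continuous P)
    (hP : ∀ x, P x ∘L P x = P x) : RealVectorBundle B :=
  subspaceBundle (fun x => (P x).range) (P (Classical.arbitrary B)).range
    (locallyTrivialFamily_range P hc hP _)

/-! ### The index bundle of a family of Fredholm operators -/

variable {X Y : Type} [NormedAddCommGroup X] [NormedSpace ℝ X]
  [NormedAddCommGroup Y] [NormedSpace ℝ Y]

/-- `V` is a finite-dimensional subspace with `im (L x) + V = Y` for all `x`. -/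
structure IsTransversal (L : B → X →L[ℝ] Y) (V : Submodule ℝ Y) : Prop where
  finite : FiniteDimensional ℝ V
  sup_eq_top : ∀ x, (L x).range ⊔ V = ⊤

theorem exists_isTransversal [CompleteSpace X] [CompleteSpace Y] [CompactSpace B]
    (L : B → X →L[ℝ] Y) (hc : Continuous L) (hF : ∀ x, (L x).IsFredholm) :
    ∃ V, IsTransversal L V := by
  have hloc : ∀ x₀, ∃ V : Submodule ℝ Y, FiniteDimensional ℝ V ∧
      ∀ᶠ x in 𝓝 x₀, (L x).range ⊔ V = ⊤ := by
    intro x₀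
    obtain ⟨K, hK⟩ := (hF x₀).closedComplemented_ker.exists_isTopCompl
    obtain ⟨V, hV⟩ := (hF x₀).closedComplemented_range.exists_isTopCompl
    have hVf : FiniteDimensional ℝ V :=
      .of_fg <| (hF x₀).finite_coker.fg_of_isCompl hV.isCompl
    have hKc : IsClosed (K : Set X) := hK.symm.isClosed
    have : CompleteSpace K := hKc.completeSpace_coe
    let T : B → (K × V) →L[ℝ] Y := fun x =>
      (L x ∘L K.subtypeL) ∘L ContinuousLinearMap.fst ℝ K V +
        V.subtypeL ∘L ContinuousLinearMap.snd ℝ K V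
    have hT : Continuous T :=
      ((hc.clm_comp continuous_const).clm_comp continuous_const).add continuous_const
    have hTa : ∀ x (p : K × V), T x p = L x p.1 + p.2 := fun x p => rfl
    have hbij : Function.Bijective (T x₀) := by
      constructor
      · rw [injective_iff_map_eq_zero]
        rintro ⟨k, v⟩ h0
        rw [hTa] at h0
        have hv : (v : Y) = L x₀ (-k) := by
          rw [map_neg]
          exact (neg_eq_of_add_eq_zero_right h0).symm
        have hv0 : (v : Y) = 0 :=
          (Submodule.disjoint_def.1 hV.isCompl.disjoint) v (hv ▸ ⟨_, rfl⟩) v.2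
        have hk0 : (k : X) = 0 := by
          refine (Submodule.disjoint_def.1 hK.isCompl.disjoint) k ?_ k.2
          have h1 : L x₀ k + (v : Y) = 0 := h0
          rw [hv0, add_zero] at h1
          exact h1
        exact Prod.ext (Subtype.ext hk0) (Subtype.ext hv0)
      · intro y
        have hy : y ∈ (L x₀).range ⊔ V := by
          rw [hV.isCompl.sup_eq_top]
          trivial
        obtain ⟨_, ⟨x, rfl⟩, v, hv, rfl⟩ := Submodule.mem_sup.1 hy
        have hxK : x ∈ (L x₀).ker ⊔ K := by
          rw [hK.isCompl.sup_eq_top]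
          trivial
        obtain ⟨a, ha, k, hk, rfl⟩ := Submodule.mem_sup.1 hxK
        refine ⟨(⟨k, hk⟩, ⟨v, hv⟩), ?_⟩
        have ha' : L x₀ a = 0 := ha
        simp [hTa, ha']
    obtain ⟨U, hU, hx, R, -, hinv⟩ := exists_local_inverse T hT x₀ hbij
    refine ⟨V, hVf, Filter.mem_of_superset (hU.mem_nhds hx) fun x hxU => ?_⟩
    refine (Submodule.eq_top_iff'.2 fun y => ?_)
    rw [← (hinv x hxU).1 y, hTa]
    exact Submodule.add_mem_sup ⟨_, rfl⟩ (R x y).2.2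
  choose V hVf hV using hloc
  obtain ⟨t, ht⟩ := CompactSpace.elim_nhds_subcover
    (fun x₀ => {x | (L x).range ⊔ V x₀ = ⊤}) hV
  refine ⟨t.sup V, Submodule.finiteDimensional_finset_sup t V, fun x => ?_⟩
  have hx : x ∈ ⋃ x₀ ∈ t, {x | (L x).range ⊔ V x₀ = ⊤} := by
    rw [ht]
    trivial
  simp only [mem_iUnion] at hx
  obtain ⟨x₀, hx₀, h⟩ := hx
  exact top_le_iff.1 (h.symm.le.trans (sup_le_sup_left (Finset.le_sup hx₀) _))

theorem finiteDimensional_preimage {T : X →L[ℝ] Y} (hT : T.IsFredholm) (V : Submodule ℝ Y)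
    [FiniteDimensional ℝ V] : FiniteDimensional ℝ (V.comap T.toLinearMap) := by
  have := hT.finite_ker
  let f : V.comap T.toLinearMap →ₗ[ℝ] V := T.toLinearMap.restrict fun x hx => hx
  have hk : FiniteDimensional ℝ (LinearMap.ker f) := by
    let i : LinearMap.ker f →ₗ[ℝ] T.ker :=
      { toFun := fun v => ⟨v.1.1, congrArg Subtype.val (LinearMap.mem_ker.1 v.2)⟩
        map_add' := fun _ _ => rfl
        map_smul' := fun _ _ => rfl }
    refine FiniteDimensional.of_injective i fun v w h => ?_
    exact Subtype.ext (Subtype.ext (congrArg (fun z : T.ker => (z : X)) h))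
  have hr : FiniteDimensional ℝ (LinearMap.range f) := inferInstance
  have := Module.Finite.equiv f.quotKerEquivRange.symm
  exact Module.Finite.of_submodule_quotient (LinearMap.ker f)

/-- The family of subspaces `(L x)⁻¹(V)` is locally trivial. -/
theorem locallyTrivialFamily_preimage [CompleteSpace X] [CompleteSpace Y] [PreconnectedSpace B]
    (L : B → X →L[ℝ] Y) (hc : Continuous L) (hF : ∀ x, (L x).IsFredholm) (V : Submodule ℝ Y)
    (hV : IsTransversal L V) (b : B) :
    LocallyTrivialFamily (fun x => V.comap (L x).toLinearMap) (V.comap (L b).toLinearMap) := by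
  have := hV.finite
  have hfin : ∀ x, FiniteDimensional ℝ (V.comap (L x).toLinearMap) :=
    fun x => finiteDimensional_preimage (hF x) V
  refine locallyTrivialFamily_of_local (fun x => V.comap (L x).toLinearMap) (fun x₀ => ?_) b
  have hVc : IsClosed (V : Set Y) := V.closed_of_finiteDimensional
  let W : Submodule ℝ X := V.comap (L x₀).toLinearMap
  have hWf : FiniteDimensional ℝ W := hfin x₀
  have hWc : CompleteSpace W := FiniteDimensional.complete ℝ W
  obtain ⟨q, hq⟩ := Submodule.ClosedComplemented.of_finiteDimensional (𝕜 := ℝ) W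
  let T : B → X →L[ℝ] (Y ⧸ V) × W := fun x => (V.mkQL ∘L L x).prod q
  have hT : Continuous T := by
    have h1 : T = fun x => ContinuousLinearMap.inl ℝ (Y ⧸ V) W ∘L (V.mkQL ∘L L x) +
        ContinuousLinearMap.inr ℝ (Y ⧸ V) W ∘L q := by
      funext x
      ext v <;> simp [T]
    rw [h1]
    exact (continuous_const.clm_comp (continuous_const.clm_comp hc)).add continuous_const
  have hTa : ∀ x v, T x v = (V.mkQ (L x v), q v) := fun x v => rfl
  have hker : ∀ x v, V.mkQ (L x v) = 0 ↔ v ∈ V.comap (L x).toLinearMap := by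
    intro x v
    rw [Submodule.mkQ_apply, Submodule.Quotient.mk_eq_zero]
    rfl
  have hbij : Function.Bijective (T x₀) := by
    constructor
    · rw [injective_iff_map_eq_zero]
      intro v h0
      rw [hTa, Prod.mk_eq_zero] at h0
      have hq0 : q v = 0 := h0.2
      exact (congrArg Subtype.val (hq ⟨v, (hker x₀ v).1 h0.1⟩)).symm.trans
        (congrArg Subtype.val hq0)
    · rintro ⟨y, w⟩
      obtain ⟨y, rfl⟩ := V.mkQ_surjective y
      have hy : y ∈ (L x₀).range ⊔ V := by
        rw [hV.sup_eq_top x₀]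
        trivial
      obtain ⟨_, ⟨x, rfl⟩, v, hv, rfl⟩ := Submodule.mem_sup.1 hy
      refine ⟨x - q x + w, ?_⟩
      have h4 : V.mkQ (L x₀ (q x : X)) = 0 := (hker x₀ _).2 (q x).2
      have h5 : V.mkQ (L x₀ (w : X)) = 0 := (hker x₀ _).2 w.2
      have h6 : V.mkQ v = 0 := by
        rw [Submodule.mkQ_apply, Submodule.Quotient.mk_eq_zero]
        exact hv
      rw [hTa]
      refine Prod.ext ?_ ?_
      · change V.mkQ (L x₀ (x - q x + w)) = V.mkQ (L x₀ x + v)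
        rw [map_add, map_sub, map_add, map_sub, map_add, h4, h5, h6]
        simp
      · change q (x - q x + w) = w
        rw [map_add, map_sub, hq, hq]
        simp
  obtain ⟨U, hU, hx, R, hR, hinv⟩ := exists_local_inverse T hT x₀ hbij
  refine ⟨U, hU, hx, q, fun x => R x ∘L ContinuousLinearMap.inr ℝ (Y ⧸ V) W,
    hR.clm_comp continuousOn_const, fun x hxU => ?_⟩
  obtain ⟨h1, h2⟩ := hinv x hxU
  refine ⟨fun w => ?_, fun w => ?_, fun v hv => ?_⟩
  · exact (hker x _).1 (congrArg Prod.fst (h1 (0, w)))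
  · exact congrArg Prod.snd (h1 (0, w))
  · have h3 := h2 v
    rw [hTa, (hker x v).2 hv] at h3
    exact h3

/-- The bundle `E(L, V) = {(x, v) | L x v ∈ V}` for a transversal subspace `V`. -/
def preimageBundle [CompleteSpace X] [CompleteSpace Y] [ConnectedSpace B]
    (L : B → X →L[ℝ] Y) (hc : Continuous L) (hF : ∀ x, (L x).IsFredholm) (V : Submodule ℝ Y)
    (hV : IsTransversal L V) : RealVectorBundle B :=
  haveI := hV.finite
  haveI := finiteDimensional_preimage (hF (Classical.arbitrary B)) V
  subspaceBundle (fun x => V.comap (L x).toLinearMap)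
    (V.comap (L (Classical.arbitrary B)).toLinearMap)
    (locallyTrivialFamily_preimage L hc hF V hV _)

/-- `[E(L, V)] - [Θ(V)] ∈ KO(B)` for a transversal subspace `V`. -/
def indexClass [CompleteSpace X] [CompleteSpace Y] [ConnectedSpace B]
    (L : B → X →L[ℝ] Y) (hc : Continuous L) (hF : ∀ x, (L x).IsFredholm) (V : Submodule ℝ Y)
    (hV : IsTransversal L V) : KO B :=
  haveI := hV.finite
  (preimageBundle L hc hF V hV).koClass - (RealVectorBundle.trivial B V).koClass

/-- The index bundle of a continuous family of Fredholm operators over a compact connected space: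
`[E(L, V)] - [Θ(V)]` for a finite-dimensional subspace `V` transversal to all images. (The class
does not depend on `V`.) -/
def indexBundle [CompleteSpace X] [CompleteSpace Y] [CompactSpace B] [ConnectedSpace B]
    (L : B → X →L[ℝ] Y) (hc : Continuous L) (hF : ∀ x, (L x).IsFredholm) : KO B :=
  indexClass L hc hF (exists_isTransversal L hc hF).choose
    (exists_isTransversal L hc hF).choose_spec

end Families

/-! ### Linear difference equations -/

/-- `ℝᵈ` with the Euclidean norm. -/
abbrev Euc (d : ℕ) : Type := EuclideanSpace ℝ (Fin d)

/-- `ℓ₀(ℝᵈ)`: the Banach space of sequences `φ : ℤ → ℝᵈ` with `φ n → 0` as `n → ±∞`, with the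
supremum norm. -/
abbrev EllZero (d : ℕ) : Type := C₀(ℤ, Euc d)

/-- The left shift `(S φ)(n) = φ (n + 1)` on `ℓ₀(ℝᵈ)`. -/
def leftShift (d : ℕ) : EllZero d →L[ℝ] EllZero d :=
  LinearMap.mkContinuous
    { toFun := fun φ =>
        { toFun := fun n => φ (n + 1)
          continuous_toFun := continuous_of_discreteTopology
          zero_at_infty' := φ.zero_at_infty'.comp
            (Homeomorph.addRight (1 : ℤ)).isClosedEmbedding.tendsto_cocompact }
      map_add' := fun _ _ => rfl
      map_smul' := fun _ _ => rfl } 1 (by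
    intro φ
    rw [one_mul, ← ZeroAtInftyContinuousMap.norm_toBCF_eq_norm,
      BoundedContinuousFunction.norm_le (norm_nonneg _)]
    intro n
    rw [← ZeroAtInftyContinuousMap.norm_toBCF_eq_norm]
    exact φ.toBCF.norm_coe_le_norm (n + 1))

/-- The operator `(N φ)(n) = A n (φ n)` on `ℓ₀(ℝᵈ)` for a bounded sequence `A`. -/
def nemitski {d : ℕ} (A : ℤ → Euc d →L[ℝ] Euc d) (hA : ∃ C, ∀ n, ‖A n‖ ≤ C) :
    EllZero d →L[ℝ] EllZero d :=
  LinearMap.mkContinuousOfExistsBound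
    { toFun := fun φ =>
        { toFun := fun n => A n (φ n)
          continuous_toFun := continuous_of_discreteTopology
          zero_at_infty' := by
            obtain ⟨C, hC⟩ := hA
            refine squeeze_zero_norm (a := fun n => C * ‖φ n‖) (fun n => ?_) ?_
            · exact (A n).le_of_opNorm_le (hC n) _
            · simpa using (φ.zero_at_infty'.norm.const_mul C) }
      map_add' := fun φ ψ => by
        ext1 n
        exact (A n).map_add _ _
      map_smul' := fun c φ => by
        ext1 n
        exact (A n).map_smul _ _ } (by
    obtain ⟨C, hC⟩ := hA
    have hC0 : 0 ≤ C := (norm_nonneg _).trans (hC 0)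
    refine ⟨C, fun φ => ?_⟩
    rw [← ZeroAtInftyContinuousMap.norm_toBCF_eq_norm,
      BoundedContinuousFunction.norm_le (mul_nonneg hC0 (norm_nonneg _))]
    intro n
    refine ((A n).le_of_opNorm_le (hC n) _).trans (mul_le_mul_of_nonneg_left ?_ hC0)
    rw [← ZeroAtInftyContinuousMap.norm_toBCF_eq_norm]
    exact φ.toBCF.norm_coe_le_norm n)

/-- The standing assumption on a parametrized linear discrete vector field `A`: the family
`(A · n)`, `n ∈ ℤ`, is equicontinuous and pointwise bounded. -/
structure IsLinearVectorField {P : Type*} [TopologicalSpace P] {d : ℕ}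
    (A : P → ℤ → Euc d →L[ℝ] Euc d) : Prop where
  equicontinuous : Equicontinuous (fun (n : ℤ) (p : P) => A p n)
  bounded : ∀ p, ∃ C, ∀ n, ‖A p n‖ ≤ C

/-- The family of operators `L_A(p) = S - N_{A(p)}` on `ℓ₀(ℝᵈ)`. -/
def differenceOperator {P : Type*} [TopologicalSpace P] {d : ℕ}
    {A : P → ℤ → Euc d →L[ℝ] Euc d} (hA : IsLinearVectorField A) (p : P) :
    EllZero d →L[ℝ] EllZero d :=
  leftShift d - nemitski (A p) (hA.bounded p)

/-- `A (n + m - 1) ∘ ⋯ ∘ A (n + 1) ∘ A n`. -/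
def evolution {d : ℕ} (A : ℤ → Euc d →L[ℝ] Euc d) (n : ℤ) : ℕ → Euc d →L[ℝ] Euc d
  | 0 => ContinuousLinearMap.id ℝ _
  | m + 1 => A (n + m) ∘L evolution A n m

/-- The transition operator `Φ(k, n) = A (k - 1) ∘ ⋯ ∘ A n` for `n ≤ k`, with `Φ(n, n) = id`. -/
def transitionOperator {d : ℕ} (A : ℤ → Euc d →L[ℝ] Euc d) (k n : ℤ) : Euc d →L[ℝ] Euc d :=
  evolution A n (k - n).toNat

/-- The vector field `A` has an exponential dichotomy on the discrete interval `I` with the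
projector `Q` and the constants `K`, `α`. Only the values `Q n` with `n ∈ I` matter. -/
structure IsDichotomy {d : ℕ} (A Q : ℤ → Euc d →L[ℝ] Euc d) (I : Set ℤ) (K α : ℝ) : Prop where
  projector : ∀ n ∈ I, Q n ∘L Q n = Q n
  invariant : ∀ n ∈ I, n + 1 ∈ I → Q (n + 1) ∘L A n = A n ∘L Q n
  bounded : ∃ C, ∀ n ∈ I, ‖Q n‖ ≤ C
  /-- regularity: `A n` restricts to an isomorphism of `ker (Q n)` onto `ker (Q (n + 1))` -/
  regular : ∀ n ∈ I, n + 1 ∈ I →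
    BijOn (A n) ((Q n).ker : Set (Euc d)) ((Q (n + 1)).ker : Set (Euc d))
  stable : ∀ n ∈ I, ∀ k ∈ I, n ≤ k → ∀ x,
    ‖transitionOperator A k n (Q n x)‖ ≤ K * α ^ (k - n) * ‖Q n x‖
  unstable : ∀ n ∈ I, ∀ k ∈ I, n ≤ k → ∀ x,
    (1 / K) * (1 / α) ^ (k - n) * ‖x - Q n x‖ ≤ ‖transitionOperator A k n (x - Q n x)‖

/-- The parametrized vector field `A` has an exponential dichotomy on `I` with the parametrized
projector `Q`: each `Q · n`, `n ∈ I`, is continuous, and every `A p` has an exponential dichotomy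
with `Q p`, with constants `K ≥ 1` and `α ∈ (0, 1)` independent of `p`. -/
structure HasDichotomyWith {P : Type*} [TopologicalSpace P] {d : ℕ}
    (A Q : P → ℤ → Euc d →L[ℝ] Euc d) (I : Set ℤ) : Prop where
  continuous : ∀ n ∈ I, Continuous (fun p => Q p n)
  dichotomy : ∃ K α : ℝ, 1 ≤ K ∧ 0 < α ∧ α < 1 ∧ ∀ p, IsDichotomy (A p) (Q p) I K α

theorem HasDichotomyWith.projector {P : Type*} [TopologicalSpace P] {d : ℕ}
    {A Q : P → ℤ → Euc d →L[ℝ] Euc d} {I : Set ℤ} (h : HasDichotomyWith A Q I) {n : ℤ}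
    (hn : n ∈ I) (p : P) : Q p n ∘L Q p n = Q p n := by
  obtain ⟨K, α, -, -, -, hp⟩ := h.dichotomy
  exact (hp p).projector n hn

/-- The vector bundle `Im Q(n) = {(p, x) | x ∈ im (Q p n)}` of the projector of an exponential
dichotomy on `I`, for `n ∈ I`. -/
def HasDichotomyWith.imageBundle {P : Type*} [TopologicalSpace P] [ConnectedSpace P] {d : ℕ}
    {A Q : P → ℤ → Euc d →L[ℝ] Euc d} {I : Set ℤ} (h : HasDichotomyWith A Q I) {n : ℤ}
    (hn : n ∈ I) : RealVectorBundle P :=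
  _root_.imageBundle (fun p => Q p n) (h.continuous n hn) (h.projector hn)

end

/-!
The index bundle is computed from a bordered operator. Write `a = κneg`, `b = κpos`, and let `δ x`
be the sequence with the value `x` at `b - 1` and `0` elsewhere. For every parameter `p` the map
`(φ, x) ↦ (P⁺(b) φ(b), (1 - P⁻(a)) φ(a), L_A(p) φ - δ x)` is a bijection of `ℓ₀(ℝᵈ) × ℝᵈ` onto
`im P⁺(b) × ker P⁻(a) × ℓ₀(ℝᵈ)` (`bijOn_bordered_difference`): the dichotomy on `[b, ∞)` determines
`φ` there from its stable component at `b`, the dichotomy on `(-∞, a]` determines `φ` there from its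
unstable component at `a`, the evolution carries `φ` from `a` up to `b - 1`, and `x` absorbs the
mismatch in the equation at `b - 1`. Each of the two half-line problems is a fixed point equation
for weighted shifts, forward along the stable and backward along the unstable spaces, whose powers
decay geometrically by the dichotomy estimates (`IsDichotomy.bijective_sub_shifts`).

Bordering by finite-dimensional spaces does not affect the Fredholm property
(`isFredholm_of_bijective_border`), and norm continuity is the equicontinuity of `A`.

For a transversal subspace `V`, the operator `δ` has a lift `ρ` through `L_A` modulo `V` that is
continuous in the parameter (`IsTransversal.exists_continuous_lift`). Restricting the bordered
operator to the vectors `(φ + ρ x, x)` with `L_A φ ∈ V` gives a continuous fibrewise linear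
bijection `E(L_A, V) ⊕ ℝᵈ → im P⁺(b) ⊕ ker P⁻(a) ⊕ V` (`koClass_preimageBundle_add`),
and such a map is an isomorphism of bundles (`RealVectorBundle.IsIso.of_continuous`). Together with
`im P⁻(a) ⊕ ker P⁻(a) ≅ ℝᵈ` this is the asserted identity in `KO(Λ)`.
-/

/-! ### Isomorphisms of vector bundles -/

namespace RealVectorBundle

variable {B : Type u} [TopologicalSpace B]

/-- A continuous fibrewise linear bijection of vector bundles is an isomorphism: in local
trivializations it is a continuous family of invertible operators, and inversion of operators is
continuous. -/
theorem IsIso.of_continuous {E F : RealVectorBundle B} (φ : ∀ x, E.Fiber x ≃ₗ[ℝ] F.Fiber x)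
    (hφ : Continuous (fun p : E.Total => (⟨p.1, φ p.1 p.2⟩ : F.Total))) : E.IsIso F := by
  refine ⟨φ, hφ, continuous_iff_continuousAt.2 fun p₀ => ?_⟩
  rw [FiberBundle.continuousAt_totalSpace]
  refine ⟨(FiberBundle.continuous_proj F.Model F.Fiber).continuousAt, ?_⟩
  change ContinuousAt (fun p : F.Total =>
    (trivializationAt E.Model E.Fiber p₀.1 ⟨p.1, (φ p.1).symm p.2⟩).2) p₀
  set e := trivializationAt E.Model E.Fiber p₀.1
  set f := trivializationAt F.Model F.Fiber p₀.1
  have hU : IsOpen (e.baseSet ∩ f.baseSet) := e.open_baseSet.inter f.open_baseSet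
  have hp₀ : p₀.1 ∈ e.baseSet ∩ f.baseSet :=
    ⟨mem_baseSet_trivializationAt E.Model E.Fiber p₀.1,
      mem_baseSet_trivializationAt F.Model F.Fiber p₀.1⟩
  let T : B → E.Model →L[ℝ] F.Model := fun x =>
    LinearMap.toContinuousLinearMap (f.linearMapAt ℝ x ∘ₗ (φ x).toLinearMap ∘ₗ e.symmₗ ℝ x)
  have hTe : ∀ x ∈ e.baseSet ∩ f.baseSet, ∀ v : E.Fiber x,
      T x (e ⟨x, v⟩).2 = (f ⟨x, φ x v⟩).2 := by
    intro x hx v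
    have h1 : e.symmₗ ℝ x (e ⟨x, v⟩).2 = v := by
      have h2 := e.symmₗ_linearMapAt (R := ℝ) hx.1 v
      rwa [e.linearMapAt_apply, if_pos hx.1] at h2
    change f.linearMapAt ℝ x (φ x (e.symmₗ ℝ x (e ⟨x, v⟩).2)) = _
    rw [h1, f.linearMapAt_apply, if_pos hx.2]
  have hTc : ContinuousOn T (e.baseSet ∩ f.baseSet) := by
    rw [continuousOn_clm_apply]
    intro m
    have h1 : ContinuousOn (fun x => (f ((fun p : E.Total => (⟨p.1, φ p.1 p.2⟩ : F.Total))
        (e.toOpenPartialHomeomorph.symm (x, m)))).2) (e.baseSet ∩ f.baseSet) := by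
      refine continuous_snd.comp_continuousOn (f.continuousOn.comp (hφ.comp_continuousOn
        (e.toOpenPartialHomeomorph.continuousOn_symm.comp
          (continuousOn_id.prodMk continuousOn_const) ?_)) ?_)
      · intro b hb
        exact e.mem_target.2 hb.1
      · intro b hb
        rw [f.mem_source]
        change (e.toOpenPartialHomeomorph.symm (b, m)).proj ∈ f.baseSet
        rw [e.proj_symm_apply' hb.1]
        exact hb.2
    refine h1.congr fun x hx => ?_
    have h2 : e.toOpenPartialHomeomorph.symm (x, m) = ⟨x, e.symmₗ ℝ x m⟩ := by
      rw [e.symmₗ_apply hx.1, e.mk_symm hx.1]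
    change T x m = (f ((fun p : E.Total => (⟨p.1, φ p.1 p.2⟩ : F.Total))
      (e.toOpenPartialHomeomorph.symm (x, m)))).2
    rw [h2, ← hTe x hx]
    congr 1
    have h3 := e.linearMapAt_symmₗ (R := ℝ) hx.1 m
    rw [e.linearMapAt_apply, if_pos hx.1] at h3
    exact h3.symm
  have hTi : ∀ x ∈ e.baseSet ∩ f.baseSet, (T x).IsInvertible := by
    intro x hx
    let t : E.Model ≃ₗ[ℝ] F.Model :=
      ((e.linearEquivAt ℝ x hx.1).symm.trans (φ x)).trans (f.linearEquivAt ℝ x hx.2)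
    refine ⟨t.toContinuousLinearEquiv, ?_⟩
    ext m
    obtain ⟨v, rfl⟩ := (e.linearEquivAt ℝ x hx.1).surjective m
    have h1 : T x (e.linearEquivAt ℝ x hx.1 v) = (f ⟨x, φ x v⟩).2 := hTe x hx v
    rw [h1]
    change f.linearEquivAt ℝ x hx.2 (φ x ((e.linearEquivAt ℝ x hx.1).symm
      (e.linearEquivAt ℝ x hx.1 v))) = _
    rw [LinearEquiv.symm_apply_apply]
    rfl
  have hinv : ContinuousAt (fun p : F.Total => (T p.1).inverse (f p).2) p₀ := by
    have h1 : ContinuousAt T p₀.1 := hTc.continuousAt (hU.mem_nhds hp₀)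
    have h2 : ContinuousAt ContinuousLinearMap.inverse (T p₀.1) :=
      ((hTi _ hp₀).contDiffAt_map_inverse (n := 0)).continuousAt
    have h3 : ContinuousAt (fun p : F.Total => (f p).2) p₀ :=
      continuous_snd.continuousAt.comp (f.continuousAt (f.mem_source.2 hp₀.2))
    have h4 : ContinuousAt (fun p : F.Total => (T p.1).inverse) p₀ :=
      ContinuousAt.comp (f := fun p : F.Total => T p.1) h2
        (ContinuousAt.comp (f := fun p : F.Total => p.1) h1
          (FiberBundle.continuous_proj F.Model F.Fiber).continuousAt)
    exact h4.clm_apply h3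
  refine hinv.congr ?_
  filter_upwards [(hU.preimage (FiberBundle.continuous_proj F.Model F.Fiber)).mem_nhds hp₀]
    with p hp
  rw [(hTi _ hp).inverse_apply_eq, hTe _ hp, LinearEquiv.apply_symm_apply]

theorem koClass_sum (E F : RealVectorBundle B) :
    (E.sum F).koClass = E.koClass + F.koClass :=
  let c : RealVectorBundle B → BundleClass B := Quotient.mk (isoSetoid B)
  map_add Algebra.GrothendieckAddGroup.of (c E) (c F)

theorem IsIso.koClass_eq {E F : RealVectorBundle B} (h : E.IsIso F) : E.koClass = F.koClass :=
  let c : RealVectorBundle B → BundleClass B := Quotient.mk (isoSetoid B)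
  have hc : c E = c F := Quotient.sound h
  congrArg Algebra.GrothendieckAddGroup.of hc

theorem continuous_trivial_iff {Z : Type*} [TopologicalSpace Z] (V : Type) [NormedAddCommGroup V]
    [NormedSpace ℝ V] [FiniteDimensional ℝ V] (f : Z → (trivial B V).Total) :
    Continuous f ↔ Continuous (fun z => (f z).1) ∧
      Continuous (fun z => ((f z).2 : V)) :=
  (Bundle.Trivial.homeomorphProd B V).isInducing.continuous_iff.trans continuous_prodMk

theorem continuous_imageBundle_iff [ConnectedSpace B] {Z : Type*} [TopologicalSpace Z] {X : Type}
    [NormedAddCommGroup X] [NormedSpace ℝ X] [FiniteDimensional ℝ X] (P : B → X →L[ℝ] X)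
    (hc : Continuous P) (hP : ∀ x, P x ∘L P x = P x) (f : Z → (imageBundle P hc hP).Total) :
    Continuous f ↔ Continuous (fun z => (f z).1) ∧
      Continuous (fun z => (P (f z).1).range.subtype (f z).2) := by
  have h : Topology.IsInducing
    (fun p : (imageBundle P hc hP).Total => (p.1, (P p.1).range.subtype p.2)) := ⟨rfl⟩
  exact h.continuous_iff.trans continuous_prodMk

theorem continuous_preimageBundle_iff [ConnectedSpace B] {Z : Type*} [TopologicalSpace Z]
    {X Y : Type} [NormedAddCommGroup X] [NormedSpace ℝ X] [CompleteSpace X]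
    [NormedAddCommGroup Y] [NormedSpace ℝ Y] [CompleteSpace Y]
    (L : B → X →L[ℝ] Y) (hc : Continuous L) (hF : ∀ x, (L x).IsFredholm) (V : Submodule ℝ Y)
    (hV : IsTransversal L V) (f : Z → (preimageBundle L hc hF V hV).Total) :
    Continuous f ↔ Continuous (fun z => (f z).1) ∧
      Continuous (fun z => (V.comap (L (f z).1).toLinearMap).subtype (f z).2) := by
  have h : Topology.IsInducing (fun p : (preimageBundle L hc hF V hV).Total =>
    (p.1, (V.comap (L p.1).toLinearMap).subtype p.2)) := ⟨rfl⟩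
  exact h.continuous_iff.trans continuous_prodMk

end RealVectorBundle

/-! ### Bordered operators -/

open scoped LinearMap.FiniteRangeSetoid in
/-- An operator `L` that becomes bijective after bordering with finite-dimensional spaces is a
Fredholm operator: the corner of the inverse of the bordered operator is a quasi-inverse. -/
theorem isFredholm_of_bijective_border {X Y F G : Type*} [NormedAddCommGroup X] [NormedSpace ℝ X]
    [CompleteSpace X] [NormedAddCommGroup Y] [NormedSpace ℝ Y] [CompleteSpace Y]
    [NormedAddCommGroup F] [NormedSpace ℝ F] [FiniteDimensional ℝ F]
    [NormedAddCommGroup G] [NormedSpace ℝ G] [FiniteDimensional ℝ G]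
    (L : X →L[ℝ] Y) (γ : X →L[ℝ] G) (δ : F →L[ℝ] Y)
    (h : Function.Bijective fun p : X × F => (γ p.1, L p.1 - δ p.2)) : L.IsFredholm := by
  have : CompleteSpace F := FiniteDimensional.complete ℝ F
  have : CompleteSpace G := FiniteDimensional.complete ℝ G
  let M : (X × F) →L[ℝ] (G × Y) :=
    (γ ∘L ContinuousLinearMap.fst ℝ X F).prod
      (L ∘L ContinuousLinearMap.fst ℝ X F - δ ∘L ContinuousLinearMap.snd ℝ X F)
  have hM : ∀ x e, M (x, e) = (γ x, L x - δ e) := fun _ _ => rfl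
  let m : (X × F) ≃L[ℝ] (G × Y) := ContinuousLinearEquiv.ofBijective M
    (LinearMap.ker_eq_bot.2 h.1) (LinearMap.range_eq_top.2 h.2)
  have hm : ∀ x e, m (x, e) = (γ x, L x - δ e) := fun _ _ => rfl
  let v : Y →L[ℝ] X := ContinuousLinearMap.fst ℝ X F ∘L m.symm.toContinuousLinearMap ∘L
    ContinuousLinearMap.inr ℝ G Y
  refine ContinuousLinearMap.IsFredholm.of_isQuasiInverse (v := v) ⟨?_, ?_⟩
  · let a : G →ₗ[ℝ] X := -(LinearMap.fst ℝ X F ∘ₗ m.symm.toLinearEquiv.toLinearMap ∘ₗ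
      LinearMap.inl ℝ G Y)
    have ha : v.toLinearMap ∘ₗ L.toLinearMap - .id = a ∘ₗ γ.toLinearMap := by
      ext x
      have h1 : m.symm (0, L x) = (x, 0) - m.symm (γ x, 0) := by
        rw [← m.symm_apply_apply (x, 0), ← map_sub, hm]
        simp
      change (m.symm (0, L x)).1 - x = -(m.symm (γ x, 0)).1
      rw [h1]
      simp
    refine LinearMap.FiniteRangeSetoid.equiv_iff_hasNoetherianRange.2 ?_
    rw [ha]
    exact LinearMap.HasNoetherianRange.comp_right .of_isNoetherian_dom _
  · let b : Y →ₗ[ℝ] F := LinearMap.snd ℝ X F ∘ₗ m.symm.toLinearEquiv.toLinearMap ∘ₗ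
      LinearMap.inr ℝ G Y
    have hb : L.toLinearMap ∘ₗ v.toLinearMap - .id = δ.toLinearMap ∘ₗ b := by
      ext y
      have h1 := congrArg Prod.snd (m.apply_symm_apply (0, y))
      rw [← Prod.mk.eta (p := m.symm (0, y)), hm] at h1
      change L (m.symm (0, y)).1 - y = δ (m.symm (0, y)).2
      exact sub_eq_iff_eq_add'.2 (sub_eq_iff_eq_add.1 h1)
    refine LinearMap.FiniteRangeSetoid.equiv_iff_hasNoetherianRange.2 ?_
    rw [hb]
    exact LinearMap.HasNoetherianRange.comp_right .of_isNoetherian_dom _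

/-- If bordering `L` by `δ` and by the components of `ε₁`, `ε₂` in the images of `P`, `Q` gives a
bijection onto `im P × im Q × Y`, then `L` is a Fredholm operator. -/
theorem isFredholm_of_bijOn_border {X Y F E₁ E₂ : Type*}
    [NormedAddCommGroup X] [NormedSpace ℝ X] [CompleteSpace X]
    [NormedAddCommGroup Y] [NormedSpace ℝ Y] [CompleteSpace Y]
    [NormedAddCommGroup F] [NormedSpace ℝ F] [FiniteDimensional ℝ F]
    [NormedAddCommGroup E₁] [NormedSpace ℝ E₁] [FiniteDimensional ℝ E₁]
    [NormedAddCommGroup E₂] [NormedSpace ℝ E₂] [FiniteDimensional ℝ E₂]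
    (L : X →L[ℝ] Y) (δ : F →L[ℝ] Y) (ε₁ : X →L[ℝ] E₁) (ε₂ : X →L[ℝ] E₂)
    (P : E₁ →L[ℝ] E₁) (Q : E₂ →L[ℝ] E₂)
    (h : BijOn (fun p : X × F => (P (ε₁ p.1), Q (ε₂ p.1), L p.1 - δ p.2)) univ
      ((P.range : Set E₁) ×ˢ (Q.range : Set E₂) ×ˢ univ)) : L.IsFredholm := by
  refine isFredholm_of_bijective_border (G := P.range × Q.range) L
    (((P ∘L ε₁).codRestrict P.range fun v => ⟨ε₁ v, rfl⟩).prod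
      ((Q ∘L ε₂).codRestrict Q.range fun v => ⟨ε₂ v, rfl⟩)) δ ⟨fun p p' hp => ?_, ?_⟩
  · refine h.injOn (mem_univ p) (mem_univ p') ?_
    have h1 := congrArg (fun z : (P.range × Q.range) × Y => ((z.1.1 : E₁), (z.1.2 : E₂), z.2)) hp
    exact h1
  · rintro ⟨⟨⟨η, hη⟩, ⟨ξ, hξ⟩⟩, y⟩
    obtain ⟨p, -, hp⟩ := h.surjOn (show (η, ξ, y) ∈ _ from ⟨hη, hξ, mem_univ _⟩)
    refine ⟨p, Prod.ext (Prod.ext (Subtype.ext ?_) (Subtype.ext ?_)) ?_⟩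
    · exact congrArg (fun z => z.1) hp
    · exact congrArg (fun z => z.2.1) hp
    · exact congrArg (fun z => z.2.2) hp

/-! ### The index bundle of a bordered family -/

section Index

variable {B : Type u} [TopologicalSpace B]

/-- For a transversal subspace `V`, operators `δ : F → Y` lift continuously through `L` modulo `V`.
Near each point a complement of the kernel of `L x : X → Y ⧸ V` provides a lift; the lifts form a
convex set, so local lifts can be glued. -/
theorem IsTransversal.exists_continuous_lift [NormalSpace B] [ParacompactSpace B] {X Y F : Type}
    [NormedAddCommGroup X] [NormedSpace ℝ X] [CompleteSpace X]
    [NormedAddCommGroup Y] [NormedSpace ℝ Y] [CompleteSpace Y]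
    [NormedAddCommGroup F] [NormedSpace ℝ F]
    {L : B → X →L[ℝ] Y} (hc : Continuous L) (hF : ∀ x, (L x).IsFredholm) {V : Submodule ℝ Y}
    (hV : IsTransversal L V) (δ : F →L[ℝ] Y) :
    ∃ ρ : B → F →L[ℝ] X, Continuous ρ ∧ ∀ x e, L x (ρ x e) - δ e ∈ V := by
  have := hV.finite
  have hVc : IsClosed (V : Set Y) := V.closed_of_finiteDimensional
  have key := exists_continuous_forall_mem_convex_of_local
    (t := fun x => {ρ : F →L[ℝ] X | ∀ e, L x (ρ e) - δ e ∈ V}) (fun x => ?_) (fun x₀ => ?_)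
  · obtain ⟨ρ, hρ⟩ := key
    exact ⟨ρ, ρ.continuous, hρ⟩
  · intro ρ hρ σ hσ a b _ _ hab e
    have h1 : L x ((a • ρ + b • σ) e) - δ e =
        a • (L x (ρ e) - δ e) + b • (L x (σ e) - δ e) := by
      have h2 : δ e = a • δ e + b • δ e := by rw [← add_smul, hab, one_smul]
      rw [h2]
      simp only [add_apply, smul_apply, map_add, map_smul, smul_sub]
      rw [← h2]
      nth_rewrite 1 [h2]
      abel
    rw [h1]
    exact V.add_mem (V.smul_mem a (hρ e)) (V.smul_mem b (hσ e))
  · have := finiteDimensional_preimage (hF x₀) V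
    obtain ⟨K, hK⟩ := (Submodule.ClosedComplemented.of_finiteDimensional (𝕜 := ℝ)
      (V.comap (L x₀).toLinearMap)).exists_isTopCompl
    have hKc : IsClosed (K : Set X) := hK.symm.isClosed
    have : CompleteSpace K := hKc.completeSpace_coe
    let T : B → K →L[ℝ] Y ⧸ V := fun x => V.mkQL ∘L L x ∘L K.subtypeL
    have hT : Continuous T := continuous_const.clm_comp (hc.clm_comp continuous_const)
    have hTa : ∀ x k, T x k = V.mkQ (L x k) := fun _ _ => rfl
    have hbij : Function.Bijective (T x₀) := by
      constructor
      · rw [injective_iff_map_eq_zero]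
        intro k hk
        rw [hTa, Submodule.mkQ_apply, Submodule.Quotient.mk_eq_zero] at hk
        exact Subtype.ext (Submodule.disjoint_def.1 hK.isCompl.disjoint k hk k.2)
      · intro z
        obtain ⟨y, rfl⟩ := V.mkQ_surjective z
        have hy : y ∈ (L x₀).range ⊔ V := by
          rw [hV.sup_eq_top x₀]
          trivial
        obtain ⟨_, ⟨x, rfl⟩, v, hv, rfl⟩ := Submodule.mem_sup.1 hy
        have hx : x ∈ V.comap (L x₀).toLinearMap ⊔ K := by
          rw [hK.isCompl.sup_eq_top]
          trivial
        obtain ⟨w, hw, k, hk, rfl⟩ := Submodule.mem_sup.1 hx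
        refine ⟨⟨k, hk⟩, ?_⟩
        rw [hTa, Submodule.mkQ_apply, Submodule.mkQ_apply, eq_comm, Submodule.Quotient.eq]
        have h1 : L x₀ (w + k) + v - L x₀ k = L x₀ w + v := by
          rw [map_add]
          abel
        exact h1 ▸ V.add_mem hw hv
    obtain ⟨U, hU, hx₀, R, hR, hinv⟩ := exists_local_inverse T hT x₀ hbij
    refine ⟨U, hU.mem_nhds hx₀, fun x => K.subtypeL ∘L R x ∘L V.mkQL ∘L δ,
      continuousOn_const.clm_comp (hR.clm_comp continuousOn_const), fun x hx e => ?_⟩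
    exact (Submodule.Quotient.eq V).1 ((hinv x hx).1 (V.mkQ (δ e)))

variable [ConnectedSpace B]

/-- The images of complementary projections add up to the product bundle. -/
theorem koClass_imageBundle_compl {X : Type} [NormedAddCommGroup X]
    [NormedSpace ℝ X] [FiniteDimensional ℝ X] (P Q : B → X →L[ℝ] X) (hPc : Continuous P)
    (hQc : Continuous Q) (hP : ∀ x, P x ∘L P x = P x) (hQ : ∀ x, Q x ∘L Q x = Q x)
    (hPQ : ∀ x v, P x v + Q x v = v) :
    (imageBundle P hPc hP).koClass + (imageBundle Q hQc hQ).koClass =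
      (RealVectorBundle.trivial B X).koClass := by
  have hPP : ∀ x v, P x (P x v) = P x v := fun x v => congrArg (fun f => f v) (hP x)
  have hPQ0 : ∀ x v, P x (Q x v) = 0 := by
    intro x v
    have h1 := congrArg (P x) (hPQ x v)
    rwa [map_add, hPP, add_eq_left] at h1
  have hQP0 : ∀ x v, Q x (P x v) = 0 := by
    intro x v
    have h1 := hPQ x (P x v)
    rwa [hPP, add_eq_left] at h1
  rw [← RealVectorBundle.koClass_sum]
  refine RealVectorBundle.IsIso.koClass_eq (.of_continuous (fun x => LinearEquiv.ofBijective
    (((P x).range.subtype).coprod ((Q x).range.subtype)) ⟨?_, ?_⟩) ?_)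
  · rw [injective_iff_map_eq_zero]
    rintro ⟨⟨_, v, rfl⟩, ⟨_, w, rfl⟩⟩ h0
    have h1 : P x v + Q x w = 0 := h0
    have h2 : P x v = 0 := by
      have h3 := congrArg (P x) h1
      rwa [map_add, hPP, hPQ0, add_zero, map_zero] at h3
    have h4 : Q x w = 0 := by rwa [h2, zero_add] at h1
    exact Prod.ext (Subtype.ext h2) (Subtype.ext h4)
  · intro v
    exact ⟨(⟨P x v, v, rfl⟩, ⟨Q x v, v, rfl⟩), hPQ x v⟩
  · refine (RealVectorBundle.continuous_trivial_iff X _).2 ⟨?_, ?_⟩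
    · exact FiberBundle.continuous_proj _ _
    · exact ((RealVectorBundle.continuous_imageBundle_iff P hPc hP _).1
        (RealVectorBundle.continuous_sum_fst _ _)).2.add
        ((RealVectorBundle.continuous_imageBundle_iff Q hQc hQ _).1
        (RealVectorBundle.continuous_sum_snd _ _)).2

/-- If the family `L`, bordered by `δ` and by the components of `ε₁`, `ε₂` in the images of the
projections `P`, `Q`, is bijective, then `E(L, V) ⊕ F ≅ im P ⊕ im Q ⊕ V`. With a continuous lift `ρ`
of `δ` through `L` modulo `V`, the bordered operator maps `(φ + ρ e, e)` with `φ ∈ E(L, V)` and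
`e ∈ F` bijectively onto `im P × im Q × V`. -/
theorem koClass_preimageBundle_add [NormalSpace B] [ParacompactSpace B] {X Y F E₁ E₂ : Type}
    [NormedAddCommGroup X] [NormedSpace ℝ X] [CompleteSpace X]
    [NormedAddCommGroup Y] [NormedSpace ℝ Y] [CompleteSpace Y]
    [NormedAddCommGroup F] [NormedSpace ℝ F] [FiniteDimensional ℝ F]
    [NormedAddCommGroup E₁] [NormedSpace ℝ E₁] [FiniteDimensional ℝ E₁]
    [NormedAddCommGroup E₂] [NormedSpace ℝ E₂] [FiniteDimensional ℝ E₂]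
    (L : B → X →L[ℝ] Y) (hc : Continuous L) (hF : ∀ x, (L x).IsFredholm) (V : Submodule ℝ Y)
    [FiniteDimensional ℝ V] (hV : IsTransversal L V)
    (δ : F →L[ℝ] Y) (ε₁ : X →L[ℝ] E₁) (ε₂ : X →L[ℝ] E₂)
    (P : B → E₁ →L[ℝ] E₁) (hPc : Continuous P) (hP : ∀ x, P x ∘L P x = P x)
    (Q : B → E₂ →L[ℝ] E₂) (hQc : Continuous Q) (hQ : ∀ x, Q x ∘L Q x = Q x)
    (h : ∀ x, BijOn (fun p : X × F => (P x (ε₁ p.1), Q x (ε₂ p.1), L x p.1 - δ p.2)) univ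
      (((P x).range : Set E₁) ×ˢ ((Q x).range : Set E₂) ×ˢ univ)) :
    (preimageBundle L hc hF V hV).koClass + (RealVectorBundle.trivial B F).koClass =
      (imageBundle P hPc hP).koClass + ((imageBundle Q hQc hQ).koClass +
        (RealVectorBundle.trivial B V).koClass) := by
  obtain ⟨ρ, hρc, hρ⟩ := hV.exists_continuous_lift hc hF δ
  let S : B → Submodule ℝ X := fun x => V.comap (L x).toLinearMap
  -- the vector `φ + ρ e` as a linear function of `(φ, e)`
  let σ : ∀ x, (S x × F) →ₗ[ℝ] X := fun x => (S x).subtype.coprod (ρ x).toLinearMap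
  have hσ : ∀ x (p : S x × F), σ x p = p.1 + ρ x p.2 := fun _ _ => rfl
  let v : ∀ x, (S x × F) →ₗ[ℝ] Y :=
    fun x => (L x).toLinearMap ∘ₗ σ x - δ.toLinearMap ∘ₗ LinearMap.snd ℝ _ _
  have hv : ∀ x (p : S x × F), v x p = L x (σ x p) - δ p.2 := fun _ _ => rfl
  have hvV : ∀ x p, v x p ∈ V := by
    intro x p
    have h1 : v x p = L x p.1 + (L x (ρ x p.2) - δ p.2) := by
      rw [hv, hσ, map_add]
      abel
    rw [h1]
    exact V.add_mem p.1.2 (hρ x p.2)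
  let Φ : ∀ x, (S x × F) →ₗ[ℝ] ((P x).range × ((Q x).range × V)) := fun x =>
    (((P x ∘L ε₁).toLinearMap ∘ₗ σ x).codRestrict (P x).range fun p => ⟨_, rfl⟩).prod
      ((((Q x ∘L ε₂).toLinearMap ∘ₗ σ x).codRestrict (Q x).range fun p => ⟨_, rfl⟩).prod
        ((v x).codRestrict V (hvV x)))
  have hΦ : ∀ x, Function.Bijective (Φ x) := by
    intro x
    constructor
    · intro p p' hp
      have h1 := (h x).injOn (mem_univ (σ x p, p.2)) (mem_univ (σ x p', p'.2))
        (congrArg (fun z : (P x).range × ((Q x).range × V) =>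
          ((z.1 : E₁), (z.2.1 : E₂), (z.2.2 : Y))) hp)
      have h2 : p.2 = p'.2 := (Prod.ext_iff.1 h1).2
      have h3 : (p.1 : X) + ρ x p.2 = p'.1 + ρ x p'.2 := (Prod.ext_iff.1 h1).1
      rw [h2, add_left_inj] at h3
      exact Prod.ext (Subtype.ext h3) h2
    · rintro ⟨⟨η, hη⟩, ⟨ξ, hξ⟩, ⟨y, hy⟩⟩
      obtain ⟨⟨φ, e⟩, -, hφ⟩ := (h x).surjOn (show (η, ξ, y) ∈ _ from ⟨hη, hξ, mem_univ _⟩)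
      have h1 : P x (ε₁ φ) = η := congrArg (fun z => z.1) hφ
      have h2 : Q x (ε₂ φ) = ξ := congrArg (fun z => z.2.1) hφ
      have h3 : L x φ - δ e = y := congrArg (fun z => z.2.2) hφ
      have h4 : φ - ρ x e ∈ S x := by
        have h5 : L x (φ - ρ x e) = y - (L x (ρ x e) - δ e) := by
          rw [← h3, map_sub]
          abel
        change L x (φ - ρ x e) ∈ V
        rw [h5]
        exact V.sub_mem hy (hρ x e)
      have h6 : σ x (⟨φ - ρ x e, h4⟩, e) = φ := sub_add_cancel _ _
      refine ⟨(⟨φ - ρ x e, h4⟩, e), Prod.ext (Subtype.ext ?_)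
        (Prod.ext (Subtype.ext ?_) (Subtype.ext ?_))⟩
      · change P x (ε₁ (σ x (⟨φ - ρ x e, h4⟩, e))) = η
        rw [h6, h1]
      · change Q x (ε₂ (σ x (⟨φ - ρ x e, h4⟩, e))) = ξ
        rw [h6, h2]
      · change L x (σ x (⟨φ - ρ x e, h4⟩, e)) - δ e = y
        rw [h6, h3]
  rw [← RealVectorBundle.koClass_sum, ← RealVectorBundle.koClass_sum,
    ← RealVectorBundle.koClass_sum]
  let E := (preimageBundle L hc hF V hV).sum (RealVectorBundle.trivial B F)
  have hproj : Continuous fun p : E.Total => p.1 := FiberBundle.continuous_proj _ _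
  have h1 : Continuous fun p : E.Total => (S p.1).subtype p.2.1 :=
    ((RealVectorBundle.continuous_preimageBundle_iff L hc hF V hV _).1
      (RealVectorBundle.continuous_sum_fst _ _)).2
  have h2 : Continuous fun p : E.Total => (p.2.2 : F) :=
    ((RealVectorBundle.continuous_trivial_iff F _).1 (RealVectorBundle.continuous_sum_snd _ _)).2
  have hσc : Continuous fun p : E.Total => σ p.1 p.2 :=
    h1.add ((hρc.comp hproj).clm_apply h2)
  refine RealVectorBundle.IsIso.koClass_eq
    (.of_continuous (fun x => LinearEquiv.ofBijective (Φ x) (hΦ x)) ?_)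
  refine (RealVectorBundle.continuous_sum_iff _ _ _).2 ⟨?_,
    (RealVectorBundle.continuous_sum_iff _ _ _).2 ⟨?_, ?_⟩⟩
  · exact (RealVectorBundle.continuous_imageBundle_iff P hPc hP _).2
      ⟨hproj, (hPc.comp hproj).clm_apply (ε₁.continuous.comp hσc)⟩
  · exact (RealVectorBundle.continuous_imageBundle_iff Q hQc hQ _).2
      ⟨hproj, (hQc.comp hproj).clm_apply (ε₂.continuous.comp hσc)⟩
  · refine (RealVectorBundle.continuous_trivial_iff V _).2 ⟨hproj, ?_⟩
    exact Continuous.subtype_mk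
      (((hc.comp hproj).clm_apply hσc).sub (δ.continuous.comp h2)) fun p => hvV p.1 p.2

end Index

/-! ### Weighted shifts on `ℓ₀(ℝᵈ)` -/

section Shifts

variable {d : ℕ}

theorem EllZero.norm_apply_le (φ : EllZero d) (n : ℤ) : ‖φ n‖ ≤ ‖φ‖ := by
  rw [← ZeroAtInftyContinuousMap.norm_toBCF_eq_norm]
  exact φ.toBCF.norm_coe_le_norm n

theorem EllZero.norm_le {φ : EllZero d} {C : ℝ} (hC : 0 ≤ C) (h : ∀ n, ‖φ n‖ ≤ C) : ‖φ‖ ≤ C := by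
  rw [← ZeroAtInftyContinuousMap.norm_toBCF_eq_norm, BoundedContinuousFunction.norm_le hC]
  exact h

/-- The right shift `φ ↦ (n ↦ φ (n - 1))` on `ℓ₀(ℝᵈ)`. -/
noncomputable def rightShift (d : ℕ) : EllZero d →L[ℝ] EllZero d :=
  LinearMap.mkContinuous
    { toFun := fun φ =>
        { toFun := fun n => φ (n - 1)
          continuous_toFun := continuous_of_discreteTopology
          zero_at_infty' := φ.zero_at_infty'.comp
            (Homeomorph.subRight (1 : ℤ)).isClosedEmbedding.tendsto_cocompact }
      map_add' := fun _ _ => rfl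
      map_smul' := fun _ _ => rfl } 1 fun φ => by
    rw [one_mul]
    exact EllZero.norm_le (norm_nonneg _) fun n => φ.norm_apply_le (n - 1)

/-- Evaluation at `n`. -/
noncomputable def evalAt (d : ℕ) (n : ℤ) : EllZero d →L[ℝ] Euc d :=
  LinearMap.mkContinuous
    { toFun := fun φ => φ n
      map_add' := fun _ _ => rfl
      map_smul' := fun _ _ => rfl } 1 fun φ => by
    rw [one_mul]
    exact φ.norm_apply_le n

/-- The sequence with the value `x` at `m` and `0` elsewhere. -/
noncomputable def singleAt (d : ℕ) (m : ℤ) : Euc d →L[ℝ] EllZero d :=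
  LinearMap.mkContinuous
    { toFun := fun x =>
        { toFun := Pi.single m x
          continuous_toFun := continuous_of_discreteTopology
          zero_at_infty' := by
            refine tendsto_const_nhds.congr' ?_
            rw [Filter.cocompact_eq_cofinite]
            filter_upwards [(Set.finite_singleton m).compl_mem_cofinite] with n hn
            exact (Pi.single_eq_of_ne (M := fun _ => Euc d) hn x).symm }
      map_add' := fun x y => by
        ext1 n
        exact congrFun (Pi.single_add (f := fun _ => Euc d) m x y) n
      map_smul' := fun c x => by
        ext1 n
        exact congrFun (Pi.single_smul (f := fun _ => Euc d) m c x) n } 1 fun x => by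
    rw [one_mul]
    refine EllZero.norm_le (norm_nonneg _) fun n => ?_
    change ‖(Pi.single m x : ℤ → Euc d) n‖ ≤ ‖x‖
    rw [Pi.single_apply]
    split_ifs
    · exact le_rfl
    · simp

theorem singleAt_apply_self (m : ℤ) (x : Euc d) : singleAt d m x m = x :=
  Pi.single_eq_same (M := fun _ => Euc d) m x

theorem singleAt_apply_of_ne {m n : ℤ} (h : n ≠ m) (x : Euc d) : singleAt d m x n = 0 :=
  Pi.single_eq_of_ne (M := fun _ => Euc d) h x

/-- The forward weighted shift `(φ n) ↦ (T (n - 1) (φ (n - 1)))`. -/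
noncomputable def forwardShift (T : ℤ → Euc d →L[ℝ] Euc d) (hT : ∃ C, ∀ n, ‖T n‖ ≤ C) :
    EllZero d →L[ℝ] EllZero d :=
  rightShift d ∘L nemitski T hT

theorem forwardShift_apply (T : ℤ → Euc d →L[ℝ] Euc d) (hT : ∃ C, ∀ n, ‖T n‖ ≤ C)
    (φ : EllZero d) (n : ℤ) : forwardShift T hT φ n = T (n - 1) (φ (n - 1)) := rfl

/-- The backward weighted shift `(φ n) ↦ (T n (φ (n + 1)))`. -/
noncomputable def backwardShift (T : ℤ → Euc d →L[ℝ] Euc d) (hT : ∃ C, ∀ n, ‖T n‖ ≤ C) :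
    EllZero d →L[ℝ] EllZero d :=
  nemitski T hT ∘L leftShift d

theorem backwardShift_apply (T : ℤ → Euc d →L[ℝ] Euc d) (hT : ∃ C, ∀ n, ‖T n‖ ≤ C)
    (φ : EllZero d) (n : ℤ) : backwardShift T hT φ n = T n (φ (n + 1)) := rfl

end Shifts

/-- `1 - T` is bijective if some power of `T` is a strict contraction. -/
theorem bijective_sub_of_iterate_le {X : Type*} [NormedAddCommGroup X] [NormedSpace ℝ X]
    [CompleteSpace X] (T : X →L[ℝ] X) (m : ℕ) {c : ℝ} (hc0 : 0 ≤ c) (hc : c < 1)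
    (hT : ∀ x, ‖T^[m] x‖ ≤ c * ‖x‖) : Function.Bijective fun x => x - T x := by
  have h1 : IsUnit (1 - T ^ m) := by
    refine isUnit_one_sub_of_norm_lt_one
      ((ContinuousLinearMap.opNorm_le_bound _ hc0 fun x => ?_).trans_lt hc)
    rw [FunLike.coe_pow_eq_iterate]
    exact hT x
  have h2 : Commute (1 - T) (∑ i ∈ Finset.range m, T ^ i) :=
    (Commute.one_left _).sub_left (Commute.sum_right _ _ _ fun i _ => Commute.self_pow T i)
  rw [← mul_neg_geom_sum] at h1
  have h3 := (h2.isUnit_mul_iff.1 h1).1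
  obtain ⟨v, hv, hv'⟩ := isUnit_iff_exists.1 h3
  exact Function.bijective_iff_has_inverse.2 ⟨v, fun x => congrArg (fun f => f x) hv',
    fun x => congrArg (fun f => f x) hv⟩

/-- `1 - T` is bijective if the powers of `T` decay geometrically. -/
theorem bijective_sub_of_iterate_le_geometric {X : Type*} [NormedAddCommGroup X]
    [NormedSpace ℝ X] [CompleteSpace X] (T : X →L[ℝ] X) {C α : ℝ} (hC : 0 ≤ C) (h0 : 0 ≤ α)
    (h1 : α < 1) (hT : ∀ (m : ℕ) (x : X), ‖T^[m + 1] x‖ ≤ C * α ^ (m + 1) * ‖x‖) :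
    Function.Bijective fun x => x - T x := by
  have h2 : Filter.Tendsto (fun m : ℕ => C * α ^ (m + 1)) Filter.atTop (𝓝 0) := by
    simpa using ((tendsto_pow_atTop_nhds_zero_of_lt_one h0 h1).comp
      (Filter.tendsto_add_atTop_nat 1)).const_mul C
  obtain ⟨m, hm⟩ := (h2.eventually (gt_mem_nhds one_pos)).exists
  exact bijective_sub_of_iterate_le T (m + 1) (by positivity) hm (hT m)

/-! ### Green's operator of an exponential dichotomy -/

section Green

variable {d : ℕ} {A Q U : ℤ → Euc d →L[ℝ] Euc d} {I : Set ℤ} {K α : ℝ}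

theorem evolution_succ_apply (n : ℤ) (m : ℕ) (x : Euc d) :
    evolution A n (m + 1) x = A (n + m) (evolution A n m x) := rfl

theorem evolution_succ_apply' (n : ℤ) (m : ℕ) (x : Euc d) :
    evolution A n (m + 1) x = evolution A (n + 1) m (A n x) := by
  induction m with
  | zero => simp [evolution]
  | succ m ih =>
    rw [evolution_succ_apply, ih, evolution_succ_apply]
    congr 2
    push_cast
    ring

theorem transitionOperator_add (n : ℤ) (m : ℕ) :
    transitionOperator A (n + m) n = evolution A n m := by
  simp [transitionOperator]

open Classical in
/-- The operators `A n ∘ Q n` on the interval `I`, and `0` where `n` or `n + 1` is not in `I`. -/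
noncomputable def stablePart (A Q : ℤ → Euc d →L[ℝ] Euc d) (I : Set ℤ) (n : ℤ) :
    Euc d →L[ℝ] Euc d :=
  if n ∈ I ∧ n + 1 ∈ I then A n ∘L Q n else 0

theorem stablePart_apply {n : ℤ} (h : n ∈ I) (h' : n + 1 ∈ I) (x : Euc d) :
    stablePart A Q I n x = A n (Q n x) := by
  rw [stablePart, if_pos ⟨h, h'⟩]
  rfl

theorem stablePart_of_not {n : ℤ} (h : ¬ (n ∈ I ∧ n + 1 ∈ I)) : stablePart A Q I n = 0 :=
  if_neg h

/-- `U n` inverts `A n` on the unstable spaces: it is the inverse of the isomorphism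
`A n : ker (Q n) → ker (Q (n + 1))` composed with the projection onto `ker (Q (n + 1))`, and `0`
where `n` or `n + 1` is not in `I`. -/
structure IsUnstableInverse (A Q U : ℤ → Euc d →L[ℝ] Euc d) (I : Set ℤ) : Prop where
  projector_apply : ∀ n ∈ I, n + 1 ∈ I → ∀ x, Q n (U n x) = 0
  apply_inverse : ∀ n ∈ I, n + 1 ∈ I → ∀ x, A n (U n x) = x - Q (n + 1) x
  inverse_apply : ∀ n ∈ I, n + 1 ∈ I → ∀ x, U n (A n x) = x - Q n x
  eq_zero : ∀ n, ¬ (n ∈ I ∧ n + 1 ∈ I) → U n = 0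

namespace IsDichotomy

theorem projector_apply (h : IsDichotomy A Q I K α) {n : ℤ} (hn : n ∈ I) (x : Euc d) :
    Q n (Q n x) = Q n x :=
  congrArg (fun f => f x) (h.projector n hn)

theorem invariant_apply (h : IsDichotomy A Q I K α) {n : ℤ} (hn : n ∈ I) (hn' : n + 1 ∈ I)
    (x : Euc d) : Q (n + 1) (A n x) = A n (Q n x) :=
  congrArg (fun f => f x) (h.invariant n hn hn')

theorem exists_isUnstableInverse (h : IsDichotomy A Q I K α) :
    ∃ U, IsUnstableInverse A Q U I := by
  classical
  have key : ∀ n, n ∈ I ∧ n + 1 ∈ I → ∃ u : Euc d →L[ℝ] Euc d, (∀ x, Q n (u x) = 0) ∧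
      (∀ x, A n (u x) = x - Q (n + 1) x) ∧ ∀ x, u (A n x) = x - Q n x := by
    rintro n ⟨hn, hn'⟩
    have hreg := h.regular n hn hn'
    let f : (Q n).ker →ₗ[ℝ] (Q (n + 1)).ker := (A n).toLinearMap.restrict hreg.mapsTo
    have hf : Function.Bijective f := by
      constructor
      · intro v w hvw
        exact Subtype.ext (hreg.injOn v.2 w.2 (congrArg Subtype.val hvw))
      · intro w
        obtain ⟨v, hv, hvw⟩ := hreg.surjOn w.2
        exact ⟨⟨v, hv⟩, Subtype.ext hvw⟩
    let e := LinearEquiv.ofBijective f hf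
    have he : ∀ w, A n (e.symm w) = w := fun w => congrArg Subtype.val (e.apply_symm_apply w)
    let r : Euc d →ₗ[ℝ] (Q (n + 1)).ker :=
      ((ContinuousLinearMap.id ℝ (Euc d) - Q (n + 1)).toLinearMap).codRestrict _ fun x => by
        change Q (n + 1) (x - Q (n + 1) x) = 0
        rw [map_sub, h.projector_apply hn', sub_self]
    have hr : ∀ x, (r x : Euc d) = x - Q (n + 1) x := fun _ => rfl
    let u : Euc d →L[ℝ] Euc d :=
      LinearMap.toContinuousLinearMap ((Q n).ker.subtype ∘ₗ e.symm.toLinearMap ∘ₗ r)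
    have hu : ∀ x, u x = e.symm (r x) := fun _ => rfl
    refine ⟨u, fun x => (e.symm (r x)).2, fun x => ?_, fun x => ?_⟩
    · rw [hu, he, hr]
    · have hx : x - Q n x ∈ (Q n).ker := by
        change Q n (x - Q n x) = 0
        rw [map_sub, h.projector_apply hn, sub_self]
      have h1 : r (A n x) = e ⟨x - Q n x, hx⟩ := by
        refine Subtype.ext ?_
        change A n x - Q (n + 1) (A n x) = A n (x - Q n x)
        rw [h.invariant_apply hn hn', map_sub]
      rw [hu, h1, e.symm_apply_apply]
  choose u hu using key
  refine ⟨fun n => if hn : n ∈ I ∧ n + 1 ∈ I then u n hn else 0, ⟨?_, ?_, ?_, ?_⟩⟩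
  · intro n hn hn'
    rw [dif_pos ⟨hn, hn'⟩]
    exact (hu n ⟨hn, hn'⟩).1
  · intro n hn hn'
    rw [dif_pos ⟨hn, hn'⟩]
    exact (hu n ⟨hn, hn'⟩).2.1
  · intro n hn hn'
    rw [dif_pos ⟨hn, hn'⟩]
    exact (hu n ⟨hn, hn'⟩).2.2
  · intro n hn
    rw [dif_neg hn]

theorem projector_evolution (h : IsDichotomy A Q I K α) (hI : I.OrdConnected) {n : ℤ}
    (hn : n ∈ I) (m : ℕ) (hm : n + m ∈ I) (x : Euc d) :
    Q (n + m) (evolution A n m x) = evolution A n m (Q n x) := by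
  induction m with
  | zero => simp [evolution]
  | succ m ih =>
    have h1 : n + m ∈ I := hI.out hn hm ⟨by omega, by push_cast; omega⟩
    rw [evolution_succ_apply, evolution_succ_apply, ← ih h1]
    have h2 : n + ((m + 1 : ℕ) : ℤ) = n + m + 1 := by push_cast; ring
    rw [h2] at hm ⊢
    exact h.invariant_apply h1 hm _

theorem norm_evolution_le (h : IsDichotomy A Q I K α) {n : ℤ}
    (hn : n ∈ I) (m : ℕ) (hm : n + m ∈ I) (x : Euc d) :
    ‖evolution A n m (Q n x)‖ ≤ K * α ^ m * ‖Q n x‖ := by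
  have h1 := h.stable n hn (n + m) hm (by omega) x
  rwa [transitionOperator_add, add_sub_cancel_left, zpow_natCast] at h1

theorem norm_le_evolution (h : IsDichotomy A Q I K α) (hK : 1 ≤ K) (hα : 0 < α) {n : ℤ}
    (hn : n ∈ I) (m : ℕ) (hm : n + m ∈ I) {x : Euc d} (hx : Q n x = 0) :
    ‖x‖ ≤ K * α ^ m * ‖evolution A n m x‖ := by
  have h1 := h.unstable n hn (n + m) hm (by omega) x
  rw [transitionOperator_add, add_sub_cancel_left, zpow_natCast, hx, sub_zero] at h1
  have h2 : 0 < K * α ^ m := by positivity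
  calc ‖x‖ = K * α ^ m * (1 / K * (1 / α) ^ m * ‖x‖) := by
        have : K ≠ 0 := by positivity
        rw [one_div_pow]
        field_simp
    _ ≤ K * α ^ m * ‖evolution A n m x‖ := mul_le_mul_of_nonneg_left h1 h2.le

/-- The powers of the forward shift along the stable spaces are given by the evolution. -/
theorem forwardShift_pow_apply (h : IsDichotomy A Q I K α) (hI : I.OrdConnected)
    (hS : ∃ C, ∀ n, ‖stablePart A Q I n‖ ≤ C) (φ : EllZero d) (m : ℕ) (n : ℤ) :
    (n ∈ I ∧ n + (m + 1 : ℕ) ∈ I → ((forwardShift _ hS)^[m + 1] φ) (n + (m + 1 : ℕ)) =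
      evolution A n (m + 1) (Q n (φ n))) ∧
    (¬ (n ∈ I ∧ n + (m + 1 : ℕ) ∈ I) →
      ((forwardShift _ hS)^[m + 1] φ) (n + (m + 1 : ℕ)) = 0) := by
  induction m with
  | zero =>
    have h1 : ((forwardShift _ hS)^[0 + 1] φ) (n + (0 + 1 : ℕ)) = stablePart A Q I n (φ n) := by
      rw [zero_add, Function.iterate_one, forwardShift_apply]
      simp
    rw [h1]
    refine ⟨fun hn => ?_, fun hn => ?_⟩
    · rw [stablePart_apply hn.1 (by simpa using hn.2), evolution_succ_apply]
      simp [evolution]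
    · rw [stablePart_of_not (by simpa using hn)]
      rfl
  | succ m ih =>
    have h1 : ((forwardShift _ hS)^[m + 1 + 1] φ) (n + (m + 1 + 1 : ℕ)) =
        stablePart A Q I (n + (m + 1 : ℕ))
          ((forwardShift _ hS)^[m + 1] φ (n + (m + 1 : ℕ))) := by
      have h2 : n + ((m + 1 + 1 : ℕ) : ℤ) - 1 = n + (m + 1 : ℕ) := by push_cast; ring
      rw [Function.iterate_succ_apply', forwardShift_apply, h2]
    have h3 : n + (m + 1 : ℕ) + 1 = n + ((m + 1 + 1 : ℕ) : ℤ) := by push_cast; ring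
    rw [h1]
    refine ⟨fun hn => ?_, fun hn => ?_⟩
    · have h4 : n + (m + 1 : ℕ) ∈ I := hI.out hn.1 hn.2 ⟨by omega, by omega⟩
      rw [stablePart_apply h4 (h3 ▸ hn.2), ih.1 ⟨hn.1, h4⟩, h.projector_evolution hI hn.1 _ h4,
        h.projector_apply hn.1, ← evolution_succ_apply]
    · by_cases h4 : n + (m + 1 : ℕ) ∈ I ∧ n + (m + 1 : ℕ) + 1 ∈ I
      · rw [ih.2 fun h5 => hn ⟨h5.1, h3 ▸ h4.2⟩, map_zero]
      · rw [stablePart_of_not h4]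
        rfl

/-- The powers of the backward shift along the unstable spaces invert the evolution. -/
theorem backwardShift_pow_apply (hUi : IsUnstableInverse A Q U I)
    (hI : I.OrdConnected) (hU : ∃ C, ∀ n, ‖U n‖ ≤ C) (φ : EllZero d) (m : ℕ) (n : ℤ) :
    (n ∈ I ∧ n + (m + 1 : ℕ) ∈ I → Q n ((backwardShift U hU)^[m + 1] φ n) = 0 ∧
      evolution A n (m + 1) ((backwardShift U hU)^[m + 1] φ n) =
        φ (n + (m + 1 : ℕ)) - Q (n + (m + 1 : ℕ)) (φ (n + (m + 1 : ℕ)))) ∧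
    (¬ (n ∈ I ∧ n + (m + 1 : ℕ) ∈ I) → ((backwardShift U hU)^[m + 1] φ) n = 0) := by
  induction m generalizing n with
  | zero =>
    have h1 : ((backwardShift U hU)^[0 + 1] φ) n = U n (φ (n + 1)) := by
      rw [zero_add, Function.iterate_one, backwardShift_apply]
    rw [h1, evolution_succ_apply]
    simp only [zero_add, Nat.cast_one, Nat.cast_zero, add_zero]
    refine ⟨fun hn => ⟨hUi.projector_apply n hn.1 hn.2 _, hUi.apply_inverse n hn.1 hn.2 _⟩,
      fun hn => ?_⟩
    rw [hUi.eq_zero n hn]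
    rfl
  | succ m ih =>
    have h1 : ((backwardShift U hU)^[m + 1 + 1] φ) n =
        U n ((backwardShift U hU)^[m + 1] φ (n + 1)) := by
      rw [Function.iterate_succ_apply', backwardShift_apply]
    have h3 : n + 1 + (m + 1 : ℕ) = n + ((m + 1 + 1 : ℕ) : ℤ) := by push_cast; ring
    have ih' := ih (n + 1)
    rw [h3] at ih'
    rw [h1]
    refine ⟨fun hn => ?_, fun hn => ?_⟩
    · have h4 : n + 1 ∈ I := hI.out hn.1 hn.2 ⟨by omega, by omega⟩
      obtain ⟨h5, h6⟩ := ih'.1 ⟨h4, hn.2⟩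
      refine ⟨hUi.projector_apply n hn.1 h4 _, ?_⟩
      rw [evolution_succ_apply', hUi.apply_inverse n hn.1 h4, h5, sub_zero, h6]
    · by_cases h4 : n ∈ I ∧ n + 1 ∈ I
      · rw [ih'.2 fun h5 => hn ⟨h4.1, h5.2⟩, map_zero]
      · rw [hUi.eq_zero n h4]
        rfl

theorem exists_bound_stablePart (h : IsDichotomy A Q I K α) (hA : ∃ C, ∀ n, ‖A n‖ ≤ C) :
    ∃ C, ∀ n, ‖stablePart A Q I n‖ ≤ C := by
  obtain ⟨a, ha⟩ := hA
  obtain ⟨c, hc⟩ := h.bounded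
  have ha0 : 0 ≤ a := (norm_nonneg _).trans (ha 0)
  refine ⟨a * |c|, fun n => ?_⟩
  by_cases hn : n ∈ I ∧ n + 1 ∈ I
  · rw [stablePart, if_pos hn]
    exact (ContinuousLinearMap.opNorm_comp_le _ _).trans
      (mul_le_mul (ha n) ((hc n hn.1).trans (le_abs_self c)) (norm_nonneg _) ha0)
  · rw [stablePart_of_not hn, norm_zero]
    positivity

theorem exists_norm_sub_le (h : IsDichotomy A Q I K α) :
    ∃ c, 0 ≤ c ∧ ∀ n ∈ I, ∀ x, ‖Q n x‖ ≤ c * ‖x‖ ∧ ‖x - Q n x‖ ≤ c * ‖x‖ := by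
  obtain ⟨c, hc⟩ := h.bounded
  refine ⟨1 + |c|, by positivity, fun n hn x => ?_⟩
  have h1 : ‖Q n x‖ ≤ |c| * ‖x‖ := (Q n).le_of_opNorm_le ((hc n hn).trans (le_abs_self c)) x
  have h2 := norm_sub_le x (Q n x)
  have h3 := norm_nonneg x
  constructor <;> linarith

theorem exists_bound_unstableInverse (h : IsDichotomy A Q I K α) (hK : 1 ≤ K) (hα : 0 < α)
    (hUi : IsUnstableInverse A Q U I) : ∃ C, ∀ n, ‖U n‖ ≤ C := by
  obtain ⟨c, hc0, hc⟩ := h.exists_norm_sub_le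
  refine ⟨K * α * c, fun n => ContinuousLinearMap.opNorm_le_bound _ (by positivity) fun x => ?_⟩
  by_cases hn : n ∈ I ∧ n + 1 ∈ I
  · have h1 := h.norm_le_evolution hK hα hn.1 1 (by simpa using hn.2)
      (hUi.projector_apply n hn.1 hn.2 x)
    have h2 : evolution A n 1 (U n x) = x - Q (n + 1) x := by
      rw [← hUi.apply_inverse n hn.1 hn.2, ← zero_add 1, evolution_succ_apply]
      simp [evolution]
    rw [h2, pow_one] at h1
    calc ‖U n x‖ ≤ K * α * ‖x - Q (n + 1) x‖ := h1
      _ ≤ K * α * (c * ‖x‖) := mul_le_mul_of_nonneg_left (hc _ hn.2 x).2 (by positivity)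
      _ = K * α * c * ‖x‖ := by ring
  · rw [hUi.eq_zero n hn]
    simp only [zero_apply, norm_zero]
    positivity

/-- The evolution equation on `I` is a fixed point equation `φ = G φ + w`, where the operator `G`
shifts forward along the stable and backward along the unstable spaces. The exponential estimates
make `1 - G` bijective. -/
theorem bijective_sub_shifts (h : IsDichotomy A Q I K α) (hI : I.OrdConnected) (hK : 1 ≤ K)
    (hα : 0 < α) (hα1 : α < 1) (hS : ∃ C, ∀ n, ‖stablePart A Q I n‖ ≤ C)
    (hUi : IsUnstableInverse A Q U I) (hU : ∃ C, ∀ n, ‖U n‖ ≤ C) :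
    Function.Bijective fun φ =>
      φ - (forwardShift (stablePart A Q I) hS φ + backwardShift U hU φ) := by
  obtain ⟨c, hc0, hc⟩ := h.exists_norm_sub_le
  have h1 : Function.Bijective fun φ => φ - forwardShift (stablePart A Q I) hS φ := by
    refine bijective_sub_of_iterate_le_geometric (C := K * c) _ (by positivity)
      hα.le hα1 fun m φ => ?_
    refine EllZero.norm_le (by positivity) fun k => ?_
    obtain ⟨n, rfl⟩ : ∃ n, k = n + (m + 1 : ℕ) := ⟨k - (m + 1 : ℕ), by ring⟩
    obtain ⟨h2, h3⟩ := h.forwardShift_pow_apply hI hS φ m n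
    by_cases hn : n ∈ I ∧ n + (m + 1 : ℕ) ∈ I
    · rw [h2 hn]
      calc ‖evolution A n (m + 1) (Q n (φ n))‖ ≤ K * α ^ (m + 1) * ‖Q n (φ n)‖ :=
            h.norm_evolution_le hn.1 _ hn.2 _
        _ ≤ K * α ^ (m + 1) * (c * ‖φ‖) := by
            refine mul_le_mul_of_nonneg_left ((hc n hn.1 _).1.trans ?_) (by positivity)
            exact mul_le_mul_of_nonneg_left (φ.norm_apply_le n) hc0
        _ = K * c * α ^ (m + 1) * ‖φ‖ := by ring
    · rw [h3 hn, norm_zero]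
      positivity
  have h4 : Function.Bijective fun φ => φ - backwardShift U hU φ := by
    refine bijective_sub_of_iterate_le_geometric (C := K * c) _ (by positivity)
      hα.le hα1 fun m φ => ?_
    refine EllZero.norm_le (by positivity) fun n => ?_
    obtain ⟨h2, h3⟩ := backwardShift_pow_apply hUi hI hU φ m n
    by_cases hn : n ∈ I ∧ n + (m + 1 : ℕ) ∈ I
    · obtain ⟨h5, h6⟩ := h2 hn
      have h7 := h.norm_le_evolution hK hα hn.1 _ hn.2 h5
      rw [h6] at h7
      refine h7.trans ?_
      calc K * α ^ (m + 1) * ‖φ (n + (m + 1 : ℕ)) - Q (n + (m + 1 : ℕ)) (φ (n + (m + 1 : ℕ)))‖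
          ≤ K * α ^ (m + 1) * (c * ‖φ‖) := by
            refine mul_le_mul_of_nonneg_left ((hc _ hn.2 _).2.trans ?_) (by positivity)
            exact mul_le_mul_of_nonneg_left (φ.norm_apply_le _) hc0
        _ = K * c * α ^ (m + 1) * ‖φ‖ := by ring
    · rw [h3 hn, norm_zero]
      positivity
  have h5 : ∀ φ, forwardShift (stablePart A Q I) hS (backwardShift U hU φ) = 0 := by
    intro φ
    ext1 n
    change stablePart A Q I (n - 1) (U (n - 1) (φ (n - 1 + 1))) = 0
    by_cases hn : n - 1 ∈ I ∧ n - 1 + 1 ∈ I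
    · rw [stablePart_apply hn.1 hn.2, hUi.projector_apply _ hn.1 hn.2, map_zero]
    · rw [stablePart_of_not hn]
      rfl
  convert h1.comp h4 using 2 with φ
  simp only [Function.comp_apply, map_sub, h5]
  abel

/-- The stable and unstable components of the evolution equation imply the equation. -/
theorem step_of_components (hUi : IsUnstableInverse A Q U I) {n : ℤ} (hn : n ∈ I)
    (hn' : n + 1 ∈ I) {x x' y : Euc d} (hs : Q (n + 1) x' = A n (Q n x) + Q (n + 1) y)
    (hu : x - Q n x = U n (x' - y)) : x' - A n x = y := by
  have h1 := hUi.apply_inverse n hn hn' (x' - y)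
  rw [← hu, map_sub, map_sub, hs, add_sub_cancel_right] at h1
  have h2 : A n x = x' - y := by
    rw [sub_left_inj] at h1
    exact h1
  rw [h2, sub_sub_cancel]

end IsDichotomy

end Green

/-! ### The bordered difference operator -/

section Border

variable {d : ℕ} {A Q U : ℤ → Euc d →L[ℝ] Euc d} {I : Set ℤ} {K α : ℝ}

/-- The sum of the forward shift along the stable and the backward shift along the unstable
spaces on `I`. -/
noncomputable def dichotomyShift (A Q U : ℤ → Euc d →L[ℝ] Euc d) (I : Set ℤ)
    (hS : ∃ C, ∀ n, ‖stablePart A Q I n‖ ≤ C) (hU : ∃ C, ∀ n, ‖U n‖ ≤ C) :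
    EllZero d →L[ℝ] EllZero d :=
  forwardShift (stablePart A Q I) hS + backwardShift U hU

theorem dichotomyShift_apply (hS : ∃ C, ∀ n, ‖stablePart A Q I n‖ ≤ C) (hU : ∃ C, ∀ n, ‖U n‖ ≤ C)
    (φ : EllZero d) (n : ℤ) : dichotomyShift A Q U I hS hU φ n =
      stablePart A Q I (n - 1) (φ (n - 1)) + U n (φ (n + 1)) := rfl

theorem stablePart_sub_one_apply {n : ℤ} (h : n - 1 ∈ I) (h' : n ∈ I) (x : Euc d) :
    stablePart A Q I (n - 1) x = A (n - 1) (Q (n - 1) x) :=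
  stablePart_apply h (by rwa [sub_add_cancel]) x

theorem stablePart_sub_one_of_not {n : ℤ} (h : ¬ (n - 1 ∈ I ∧ n ∈ I)) :
    stablePart A Q I (n - 1) = 0 :=
  stablePart_of_not (by rwa [sub_add_cancel])

theorem IsDichotomy.invariant_sub_one_apply (h : IsDichotomy A Q I K α) {n : ℤ} (hn : n - 1 ∈ I)
    (hn' : n ∈ I) (x : Euc d) : Q n (A (n - 1) x) = A (n - 1) (Q (n - 1) x) := by
  have h1 := h.invariant_apply hn (by rwa [sub_add_cancel]) x
  rwa [sub_add_cancel] at h1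

theorem IsUnstableInverse.dichotomyShift_apply_of_notMem (hUi : IsUnstableInverse A Q U I)
    (hS : ∃ C, ∀ n, ‖stablePart A Q I n‖ ≤ C) (hU : ∃ C, ∀ n, ‖U n‖ ≤ C) (φ : EllZero d) {n : ℤ}
    (hn : n ∉ I) : dichotomyShift A Q U I hS hU φ n = 0 := by
  rw [dichotomyShift_apply, stablePart_sub_one_of_not fun h => hn h.2,
    hUi.eq_zero n fun h => hn h.1]
  exact add_zero 0

theorem IsUnstableInverse.dichotomyShift_eq_zero (hUi : IsUnstableInverse A Q U I)
    (hS : ∃ C, ∀ n, ‖stablePart A Q I n‖ ≤ C) (hU : ∃ C, ∀ n, ‖U n‖ ≤ C) (φ : EllZero d)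
    (hφ : ∀ n ∈ I, φ n = 0) : dichotomyShift A Q U I hS hU φ = 0 := by
  ext1 n
  change stablePart A Q I (n - 1) (φ (n - 1)) + U n (φ (n + 1)) = 0
  have h1 : stablePart A Q I (n - 1) (φ (n - 1)) = 0 := by
    by_cases hn : n - 1 ∈ I
    · rw [hφ _ hn, map_zero]
    · rw [stablePart_of_not fun h => hn h.1]
      rfl
  have h2 : U n (φ (n + 1)) = 0 := by
    by_cases hn : n + 1 ∈ I
    · rw [hφ _ hn, map_zero]
    · rw [hUi.eq_zero _ fun h => hn h.2]
      rfl
  rw [h1, h2, add_zero]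

/-- The operators `A n` for `a ≤ n < b - 1`, and `0` for all other `n`. -/
def middlePart (A : ℤ → Euc d →L[ℝ] Euc d) (a b n : ℤ) : Euc d →L[ℝ] Euc d :=
  if a ≤ n ∧ n < b - 1 then A n else 0

theorem exists_bound_middlePart (hA : ∃ C, ∀ n, ‖A n‖ ≤ C) (a b : ℤ) :
    ∃ C, ∀ n, ‖middlePart A a b n‖ ≤ C := by
  obtain ⟨C, hC⟩ := hA
  refine ⟨C, fun n => ?_⟩
  rw [middlePart]
  split_ifs
  · exact hC n
  · rw [norm_zero]
    exact (norm_nonneg _).trans (hC 0)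

theorem forwardShift_middlePart_apply_eq_zero {a b : ℤ}
    (hN : ∃ C, ∀ n, ‖middlePart A a b n‖ ≤ C) (φ : EllZero d) {n : ℤ} (hn : n ≤ a ∨ b ≤ n) :
    forwardShift _ hN φ n = 0 := by
  rw [forwardShift_apply, middlePart, if_neg (by omega)]
  rfl

theorem forwardShift_middlePart_apply {a b : ℤ}
    (hN : ∃ C, ∀ n, ‖middlePart A a b n‖ ≤ C) (φ : EllZero d) {n : ℤ} (ha : a < n) (hb : n < b) :
    forwardShift _ hN φ n = A (n - 1) (φ (n - 1)) := by
  rw [forwardShift_apply, middlePart, if_pos (by omega)]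

/-- The forward shift along the finitely many operators between `a` and `b` is nilpotent. -/
theorem bijective_sub_forwardShift_middlePart {a b : ℤ}
    (hN : ∃ C, ∀ n, ‖middlePart A a b n‖ ≤ C) :
    Function.Bijective fun φ => φ - forwardShift (middlePart A a b) hN φ := by
  have h1 : ∀ (m : ℕ) (φ : EllZero d) (n : ℤ), n ≤ a + m ∨ b ≤ n →
      ((forwardShift (middlePart A a b) hN)^[m + 1] φ) n = 0 := by
    intro m φ
    induction m with
    | zero =>
      intro n hn
      rw [Function.iterate_succ_apply']
      exact forwardShift_middlePart_apply_eq_zero hN _ (by simpa using hn)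
    | succ m ih =>
      intro n hn
      rw [Function.iterate_succ_apply', forwardShift_apply]
      by_cases h2 : n - 1 ≤ a + m
      · rw [ih _ (Or.inl h2), map_zero]
      · rw [middlePart, if_neg (by push_cast at hn; omega)]
        rfl
  refine bijective_sub_of_iterate_le _ ((b - a).toNat + 1) le_rfl zero_lt_one fun φ => ?_
  rw [zero_mul]
  refine EllZero.norm_le le_rfl fun n => ?_
  rw [h1 _ _ _ (by omega), norm_zero]

/-- The difference operator, bordered at `b - 1`, together with the unstable component at `a` and
the stable component at `b`, is bijective. The equations for an element of `ℓ₀(ℝᵈ)` amount to a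
fixed point equation `φ = G⁺ φ + G⁻ φ + N φ + w` with the shifts `G⁺`, `G⁻` of the two dichotomies
and a nilpotent `N`; the equation left out at `b - 1` determines the bordering vector. -/
theorem bijOn_bordered_difference {a b : ℤ} (hab : a < b) (hA : ∃ C, ∀ n, ‖A n‖ ≤ C)
    {P R : ℤ → Euc d →L[ℝ] Euc d} {K' α' : ℝ} (hK : 1 ≤ K) (hα : 0 < α) (hα1 : α < 1)
    (hP : IsDichotomy A P (Ici b) K α) (hK' : 1 ≤ K') (hα' : 0 < α') (hα1' : α' < 1)
    (hR : IsDichotomy A R (Iic a) K' α') :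
    BijOn (fun p : EllZero d × Euc d => (P b (evalAt d b p.1),
      (ContinuousLinearMap.id ℝ (Euc d) - R a) (evalAt d a p.1),
      (leftShift d - nemitski A hA) p.1 - singleAt d (b - 1) p.2)) univ
      (((P b).range : Set (Euc d)) ×ˢ
        ((ContinuousLinearMap.id ℝ (Euc d) - R a).range : Set (Euc d)) ×ˢ univ) := by
  obtain ⟨U, hU⟩ := hP.exists_isUnstableInverse
  obtain ⟨W, hW⟩ := hR.exists_isUnstableInverse
  have hUb := hP.exists_bound_unstableInverse hK hα hU
  have hWb := hR.exists_bound_unstableInverse hK' hα' hW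
  have hPb := hP.exists_bound_stablePart hA
  have hRb := hR.exists_bound_stablePart hA
  have hN := exists_bound_middlePart hA a b
  -- the operator of the fixed point equation
  let T : EllZero d → EllZero d := fun φ =>
    dichotomyShift A P U (Ici b) hPb hUb φ + dichotomyShift A R W (Iic a) hRb hWb φ +
      forwardShift _ hN φ
  have hT : Function.Bijective fun φ => φ - T φ := by
    have h1 : Function.Bijective fun φ => φ - dichotomyShift A P U (Ici b) hPb hUb φ :=
      hP.bijective_sub_shifts ordConnected_Ici hK hα hα1 hPb hU hUb
    have h2 : Function.Bijective fun φ => φ - dichotomyShift A R W (Iic a) hRb hWb φ :=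
      hR.bijective_sub_shifts ordConnected_Iic hK' hα' hα1' hRb hW hWb
    have h4 : ∀ φ, dichotomyShift A P U (Ici b) hPb hUb (forwardShift _ hN φ) = 0 := fun φ =>
      hU.dichotomyShift_eq_zero _ _ _ fun n hn =>
        forwardShift_middlePart_apply_eq_zero hN φ (Or.inr hn)
    have h5 : ∀ φ, dichotomyShift A R W (Iic a) hRb hWb (forwardShift _ hN φ) = 0 := fun φ =>
      hW.dichotomyShift_eq_zero _ _ _ fun n hn =>
        forwardShift_middlePart_apply_eq_zero hN φ (Or.inl hn)
    have h6 : ∀ φ, dichotomyShift A P U (Ici b) hPb hUb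
        (dichotomyShift A R W (Iic a) hRb hWb φ) = 0 := fun φ =>
      hU.dichotomyShift_eq_zero _ _ _ fun n hn =>
        hW.dichotomyShift_apply_of_notMem _ _ _ fun hn' => by
          rw [mem_Ici] at hn
          rw [mem_Iic] at hn'
          omega
    convert (h1.comp h2).comp (bijective_sub_forwardShift_middlePart hN) using 2 with φ
    simp only [T, Function.comp_apply, map_sub, h4, h5, h6, map_zero]
    abel
  have hTp : ∀ φ n, b ≤ n → T φ n =
      stablePart A P (Ici b) (n - 1) (φ (n - 1)) + U n (φ (n + 1)) := by
    intro φ n hn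
    change dichotomyShift A P U (Ici b) hPb hUb φ n + dichotomyShift A R W (Iic a) hRb hWb φ n +
      forwardShift _ hN φ n = _
    rw [hW.dichotomyShift_apply_of_notMem _ _ _ (show n ∉ Iic a from fun h => by
      rw [mem_Iic] at h; omega), forwardShift_middlePart_apply_eq_zero hN φ (Or.inr hn),
      add_zero, add_zero, dichotomyShift_apply]
  have hTm : ∀ φ n, n ≤ a → T φ n =
      stablePart A R (Iic a) (n - 1) (φ (n - 1)) + W n (φ (n + 1)) := by
    intro φ n hn
    change dichotomyShift A P U (Ici b) hPb hUb φ n + dichotomyShift A R W (Iic a) hRb hWb φ n +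
      forwardShift _ hN φ n = _
    rw [hU.dichotomyShift_apply_of_notMem _ _ _ (show n ∉ Ici b from fun h => by
      rw [mem_Ici] at h; omega), forwardShift_middlePart_apply_eq_zero hN φ (Or.inl hn),
      add_zero, zero_add, dichotomyShift_apply]
  have hT0 : ∀ φ n, a < n → n < b → T φ n = A (n - 1) (φ (n - 1)) := by
    intro φ n ha hb
    change dichotomyShift A P U (Ici b) hPb hUb φ n + dichotomyShift A R W (Iic a) hRb hWb φ n +
      forwardShift _ hN φ n = _
    rw [hU.dichotomyShift_apply_of_notMem _ _ _ (show n ∉ Ici b from fun h => by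
      rw [mem_Ici] at h; omega), hW.dichotomyShift_apply_of_notMem _ _ _ (show n ∉ Iic a from
      fun h => by rw [mem_Iic] at h; omega), forwardShift_middlePart_apply hN φ ha hb,
      add_zero, zero_add]
  refine ⟨fun p _ => ⟨⟨_, rfl⟩, ⟨_, rfl⟩, mem_univ _⟩, ?_, ?_⟩
  · rintro ⟨φ, e⟩ - ⟨φ', e'⟩ - heq
    have hb : P b ((φ - φ') b) = 0 := by
      have h1 : P b (φ b) = P b (φ' b) := congrArg (fun z => z.1) heq
      change P b (φ b - φ' b) = 0
      rw [map_sub, h1, sub_self]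
    have ha : R a ((φ - φ') a) = (φ - φ') a := by
      have h1 : φ a - R a (φ a) = φ' a - R a (φ' a) := congrArg (fun z => z.2.1) heq
      change R a (φ a - φ' a) = φ a - φ' a
      rw [map_sub]
      exact (sub_eq_sub_iff_sub_eq_sub.1 h1).symm
    have hstep : ∀ n, n ≠ b - 1 → (φ - φ') (n + 1) = A n ((φ - φ') n) := by
      intro n hn
      have h1 : φ (n + 1) - A n (φ n) - singleAt d (b - 1) e n =
          φ' (n + 1) - A n (φ' n) - singleAt d (b - 1) e' n :=
        congrArg (fun z => z.2.2 n) heq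
      rw [singleAt_apply_of_ne hn, singleAt_apply_of_ne hn, sub_zero, sub_zero,
        sub_eq_sub_iff_sub_eq_sub] at h1
      change φ (n + 1) - φ' (n + 1) = A n (φ n - φ' n)
      rw [map_sub]
      exact h1
    have hstep' : ∀ n, n ≠ b → (φ - φ') n = A (n - 1) ((φ - φ') (n - 1)) := by
      intro n hn
      have h1 := hstep (n - 1) (by omega)
      rwa [sub_add_cancel] at h1
    have hfix : T (φ - φ') = φ - φ' := by
      ext1 n
      rcases le_or_gt b n with hbn | hnb
      · have h1 : U n ((φ - φ') (n + 1)) = (φ - φ') n - P n ((φ - φ') n) := by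
          rw [hstep n (by omega), hU.inverse_apply n hbn (by rw [mem_Ici]; omega)]
        rw [hTp _ _ hbn, h1]
        rcases hbn.eq_or_lt with rfl | hbn'
        · rw [stablePart_sub_one_of_not (by simp), hb, sub_zero]
          exact zero_add _
        · have hm : n - 1 ∈ Ici b := by rw [mem_Ici]; omega
          rw [stablePart_sub_one_apply hm hbn, ← hP.invariant_sub_one_apply hm hbn,
            ← hstep' n (by omega), add_sub_cancel]
      · rcases le_or_gt n a with hna | han
        · have hm : n - 1 ∈ Iic a := by rw [mem_Iic]; omega
          have h1 : stablePart A R (Iic a) (n - 1) ((φ - φ') (n - 1)) = R n ((φ - φ') n) := by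
            rw [stablePart_sub_one_apply hm hna, ← hR.invariant_sub_one_apply hm hna,
              ← hstep' n (by omega)]
          rw [hTm _ _ hna, h1]
          rcases hna.eq_or_lt with rfl | hna'
          · rw [hW.eq_zero n (by simp), ha]
            exact add_zero _
          · rw [hstep n (by omega), hW.inverse_apply n hna (by rw [mem_Iic]; omega),
              add_sub_cancel]
        · rw [hT0 _ _ han hnb, ← hstep' n (by omega)]
    have hT00 : T 0 = 0 := by
      simp only [T, map_zero, add_zero]
    have h0 : φ - φ' = 0 := hT.1 (by simp only [hfix, hT00, sub_self])
    have hφ : φ = φ' := sub_eq_zero.1 h0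
    have he : φ (b - 1 + 1) - A (b - 1) (φ (b - 1)) - singleAt d (b - 1) e (b - 1) =
        φ' (b - 1 + 1) - A (b - 1) (φ' (b - 1)) - singleAt d (b - 1) e' (b - 1) :=
      congrArg (fun z => z.2.2 (b - 1)) heq
    rw [hφ, sub_right_inj, singleAt_apply_self, singleAt_apply_self] at he
    rw [hφ, he]
  · rintro ⟨ξ, η, y⟩ ⟨⟨ξ', hξ⟩, ⟨η', hη⟩, -⟩
    have hξ1 : P b ξ = ξ := by
      have h1 : P b ξ' = ξ := hξ
      rw [← h1, hP.projector_apply self_mem_Ici]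
    have hη1 : R a η = 0 := by
      have h1 : η' - R a η' = η := hη
      rw [← h1, map_sub, hR.projector_apply self_mem_Iic, sub_self]
    let D : ℤ → Euc d →L[ℝ] Euc d := fun n =>
      if n ≤ a then R n else if n < b then ContinuousLinearMap.id ℝ _ else
        if n = b then 0 else P n
    have hD : ∃ C, ∀ n, ‖D n‖ ≤ C := by
      obtain ⟨c, hc⟩ := hP.bounded
      obtain ⟨c', hc'⟩ := hR.bounded
      refine ⟨max (max c c') 1, fun n => ?_⟩
      by_cases h1 : n ≤ a
      · simp only [D, if_pos h1]
        exact (hc' n h1).trans ((le_max_right _ _).trans (le_max_left _ _))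
      by_cases h2 : n < b
      · simp only [D, if_neg h1, if_pos h2]
        exact ContinuousLinearMap.norm_id_le.trans (le_max_right _ _)
      by_cases h3 : n = b
      · simp only [D, if_neg h1, if_neg h2, if_pos h3, norm_zero]
        exact zero_le_one.trans (le_max_right _ _)
      · simp only [D, if_neg h1, if_neg h2, if_neg h3]
        exact (hc n (not_lt.1 h2)).trans ((le_max_left _ _).trans (le_max_left _ _))
    -- the inhomogeneity of the fixed point equation
    let w : EllZero d := nemitski D hD (rightShift d y) - nemitski U hUb y - nemitski W hWb y +
      singleAt d a η + singleAt d b ξ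
    have hw : ∀ n, w n = D n (y (n - 1)) - U n (y n) - W n (y n) + singleAt d a η n +
      singleAt d b ξ n := fun _ => rfl
    obtain ⟨φ, hφ⟩ := hT.2 w
    have hφn : ∀ n, φ n = T φ n + w n := by
      intro n
      have h1 : φ n - T φ n = w n := congrArg (fun f : EllZero d => f n) hφ
      rw [← h1, add_sub_cancel]
    have hp : ∀ n, b < n → φ n = A (n - 1) (P (n - 1) (φ (n - 1))) + P n (y (n - 1)) +
        U n (φ (n + 1) - y n) := by
      intro n hn
      have hW0 : W n = 0 := hW.eq_zero n fun h => by
        have := h.1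
        rw [mem_Iic] at this
        omega
      have hD0 : D n = P n := by
        simp only [D]
        rw [if_neg (by omega), if_neg (by omega), if_neg (by omega)]
      rw [hφn, hTp _ _ hn.le, hw, singleAt_apply_of_ne (by omega), singleAt_apply_of_ne (by omega),
        hW0, hD0, stablePart_sub_one_apply (by rw [mem_Ici]; omega) (show n ∈ Ici b from hn.le),
        map_sub (U n), zero_apply]
      abel
    have hb0 : φ b = ξ + U b (φ (b + 1) - y b) := by
      have hW0 : W b = 0 := hW.eq_zero b fun h => by
        have := h.1
        rw [mem_Iic] at this
        omega
      have hD0 : D b = 0 := by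
        simp only [D]
        rw [if_neg (by omega), if_neg (by omega), if_pos trivial]
      rw [hφn, hTp _ _ le_rfl, hw, singleAt_apply_of_ne (by omega), singleAt_apply_self,
        hW0, hD0, stablePart_sub_one_of_not (by simp), map_sub (U b)]
      simp only [zero_apply]
      abel
    have hm : ∀ n, n < a → φ n = A (n - 1) (R (n - 1) (φ (n - 1))) + R n (y (n - 1)) +
        W n (φ (n + 1) - y n) := by
      intro n hn
      have hU0 : U n = 0 := hU.eq_zero n fun h => by
        have := h.1
        rw [mem_Ici] at this
        omega
      have hD0 : D n = R n := by
        simp only [D]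
        rw [if_pos (by omega)]
      rw [hφn, hTm _ _ hn.le, hw, singleAt_apply_of_ne (by omega), singleAt_apply_of_ne (by omega),
        hU0, hD0, stablePart_sub_one_apply (by rw [mem_Iic]; omega) (show n ∈ Iic a from hn.le),
        map_sub (W n), zero_apply]
      abel
    have ha0 : φ a = A (a - 1) (R (a - 1) (φ (a - 1))) + R a (y (a - 1)) + η := by
      have hU0 : U a = 0 := hU.eq_zero a fun h => by
        have := h.1
        rw [mem_Ici] at this
        omega
      have hD0 : D a = R a := by
        simp only [D]
        rw [if_pos le_rfl]
      rw [hφn, hTm _ _ le_rfl, hw, singleAt_apply_of_ne (m := b) (by omega), singleAt_apply_self,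
        hU0, hD0, hW.eq_zero a (by simp),
        stablePart_sub_one_apply (by rw [mem_Iic]; omega) self_mem_Iic]
      simp only [zero_apply]
      abel
    have hmid : ∀ n, a < n → n < b → φ n = A (n - 1) (φ (n - 1)) + y (n - 1) := by
      intro n han hnb
      have hU0 : U n = 0 := hU.eq_zero n fun h => by
        have := h.1
        rw [mem_Ici] at this
        omega
      have hW0 : W n = 0 := hW.eq_zero n fun h => by
        have := h.1
        rw [mem_Iic] at this
        omega
      have hD0 : D n = ContinuousLinearMap.id ℝ _ := by
        simp only [D]
        rw [if_neg (by omega), if_pos hnb]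
      rw [hφn, hT0 _ _ han hnb, hw, singleAt_apply_of_ne (by omega),
        singleAt_apply_of_ne (by omega), hU0, hW0, hD0]
      simp only [zero_apply, ContinuousLinearMap.id_apply]
      abel
    -- the stable components
    have hPs : ∀ n, b < n → P n (φ n) = A (n - 1) (P (n - 1) (φ (n - 1))) + P n (y (n - 1)) := by
      intro n hn
      have h1 : n - 1 ∈ Ici b := by rw [mem_Ici]; omega
      have h2 : n ∈ Ici b := hn.le
      rw [hp n hn, map_add, map_add, hP.invariant_sub_one_apply h1 h2, hP.projector_apply h1,
        hP.projector_apply h2, hU.projector_apply n h2 (by rw [mem_Ici]; omega), add_zero]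
    have hPb' : P b (φ b) = ξ := by
      rw [hb0, map_add, hξ1, hU.projector_apply b self_mem_Ici (by simp), add_zero]
    have hRs : ∀ n, n ≤ a → R n (φ n) = A (n - 1) (R (n - 1) (φ (n - 1))) + R n (y (n - 1)) := by
      intro n hn
      have h1 : n - 1 ∈ Iic a := by rw [mem_Iic]; omega
      rcases hn.eq_or_lt with rfl | hn'
      · rw [ha0, map_add, map_add, hR.invariant_sub_one_apply h1 hn, hR.projector_apply h1,
          hR.projector_apply hn, hη1, add_zero]
      · rw [hm n hn', map_add, map_add, hR.invariant_sub_one_apply h1 hn, hR.projector_apply h1,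
          hR.projector_apply hn, hW.projector_apply n hn (by rw [mem_Iic]; omega), add_zero]
    have hsol : ∀ n, n ≠ b - 1 → φ (n + 1) - A n (φ n) = y n := by
      intro n hn
      rcases le_or_gt b n with hbn | hnb
      · have h1 : n + 1 ∈ Ici b := by rw [mem_Ici]; omega
        refine IsDichotomy.step_of_components hU hbn h1 ?_ ?_
        · have h2 := hPs (n + 1) (by omega)
          rwa [add_sub_cancel_right] at h2
        · rcases hbn.eq_or_lt with rfl | hbn'
          · rw [hPb', sub_eq_iff_eq_add']
            exact hb0
          · rw [hPs n hbn', sub_eq_iff_eq_add']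
            exact hp n hbn'
      · rcases lt_or_ge n a with hna | han
        · have h1 : n + 1 ∈ Iic a := by rw [mem_Iic]; omega
          refine IsDichotomy.step_of_components hW hna.le h1 ?_ ?_
          · have h2 := hRs (n + 1) h1
            rwa [add_sub_cancel_right] at h2
          · rw [hRs n hna.le, sub_eq_iff_eq_add']
            exact hm n hna
        · have h1 := hmid (n + 1) (by omega) (by omega)
          rw [add_sub_cancel_right] at h1
          rw [h1, add_sub_cancel_left]
    refine ⟨(φ, φ b - A (b - 1) (φ (b - 1)) - y (b - 1)), mem_univ _, Prod.ext hPb'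
      (Prod.ext ?_ ?_)⟩
    · change φ a - R a (φ a) = η
      rw [hRs a le_rfl, sub_eq_iff_eq_add']
      exact ha0
    · ext1 n
      change φ (n + 1) - A n (φ n) - singleAt d (b - 1) _ n = y n
      by_cases hn : n = b - 1
      · rw [hn, singleAt_apply_self, sub_add_cancel, sub_sub_cancel]
      · rw [singleAt_apply_of_ne hn, sub_zero, hsol n hn]

end Border

/-! ### The index bundle of the difference operators -/

theorem continuous_clm_of_eventually_le {B X Y : Type*} [TopologicalSpace B]
    [NormedAddCommGroup X] [NormedSpace ℝ X] [NormedAddCommGroup Y] [NormedSpace ℝ Y]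
    {T : B → X →L[ℝ] Y}
    (h : ∀ p₀, ∀ ε > 0, ∀ᶠ p in 𝓝 p₀, ∀ x, ‖T p x - T p₀ x‖ ≤ ε * ‖x‖) : Continuous T := by
  refine continuous_iff_continuousAt.2 fun p₀ => Metric.continuousAt_iff'.2 fun ε hε => ?_
  filter_upwards [h p₀ (ε / 2) (half_pos hε)] with p hp
  rw [dist_eq_norm]
  exact (ContinuousLinearMap.opNorm_le_bound _ (half_pos hε).le hp).trans_lt (half_lt_self hε)

theorem continuous_differenceOperator {Λ : Type*} [TopologicalSpace Λ] {d : ℕ}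
    {A : Λ → ℤ → Euc d →L[ℝ] Euc d} (hA : IsLinearVectorField A) :
    Continuous (differenceOperator hA) := by
  refine continuous_clm_of_eventually_le fun p₀ ε hε => ?_
  filter_upwards [Metric.equicontinuousAt_iff_right.1 (hA.equicontinuous p₀) ε hε] with p hp φ
  refine EllZero.norm_le (by positivity) fun n => ?_
  change ‖(φ (n + 1) - A p n (φ n)) - (φ (n + 1) - A p₀ n (φ n))‖ ≤ _
  rw [sub_sub_sub_cancel_left]
  have h1 : ‖A p₀ n - A p n‖ ≤ ε := by
    rw [← dist_eq_norm]
    exact (hp n).le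
  exact ((A p₀ n - A p n).le_of_opNorm_le h1 _).trans
    (mul_le_mul_of_nonneg_left (φ.norm_apply_le n) hε.le)

theorem mainTheorem1 {Λ : Type*} [MetricSpace Λ] [CompactSpace Λ] [PathConnectedSpace Λ] (d : ℕ)
    (A : Λ → ℤ → Euc d →L[ℝ] Euc d) (hA : IsLinearVectorField A)
    (κneg κpos : ℤ) (hneg : κneg < 0) (hpos : 0 < κpos)
    (Ppos Pneg : Λ → ℤ → Euc d →L[ℝ] Euc d)
    (hPpos : HasDichotomyWith A Ppos (Set.Ici κpos))
    (hPneg : HasDichotomyWith A Pneg (Set.Iic κneg)) :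
    ∃ (hc : Continuous (differenceOperator hA)) (hF : ∀ p, (differenceOperator hA p).IsFredholm),
      indexBundle (differenceOperator hA) hc hF =
        (hPpos.imageBundle (n := κpos) Set.self_mem_Ici).koClass -
          (hPneg.imageBundle (n := κneg) Set.self_mem_Iic).koClass ∧
      ∀ (V : Submodule ℝ (EllZero d)) (hV : IsTransversal (differenceOperator hA) V),
        indexClass (differenceOperator hA) hc hF V hV =
          (hPpos.imageBundle (n := κpos) Set.self_mem_Ici).koClass -
            (hPneg.imageBundle (n := κneg) Set.self_mem_Iic).koClass := by
  have hc := continuous_differenceOperator hA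
  -- the projections onto the unstable spaces at `κneg`
  let Q : Λ → Euc d →L[ℝ] Euc d := fun p => ContinuousLinearMap.id ℝ (Euc d) - Pneg p κneg
  have hPnegc : Continuous fun p => Pneg p κneg := hPneg.continuous κneg self_mem_Iic
  have hPnegP : ∀ p, Pneg p κneg ∘L Pneg p κneg = Pneg p κneg := hPneg.projector self_mem_Iic
  have hQc : Continuous Q := continuous_const.sub hPnegc
  have hQP : ∀ p, Q p ∘L Q p = Q p := by
    intro p
    ext1 x
    have h1 : Pneg p κneg (Pneg p κneg x) = Pneg p κneg x := congrArg (fun f => f x) (hPnegP p)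
    change x - Pneg p κneg x - Pneg p κneg (x - Pneg p κneg x) = x - Pneg p κneg x
    rw [map_sub, h1, sub_self, sub_zero]
  have hbij : ∀ p, BijOn (fun z : EllZero d × Euc d => (Ppos p κpos (evalAt d κpos z.1),
      Q p (evalAt d κneg z.1), differenceOperator hA p z.1 - singleAt d (κpos - 1) z.2)) univ
      (((Ppos p κpos).range : Set (Euc d)) ×ˢ ((Q p).range : Set (Euc d)) ×ˢ univ) := by
    intro p
    obtain ⟨K, α, hK, hα, hα1, hP⟩ := hPpos.dichotomy
    obtain ⟨K', α', hK', hα', hα1', hR⟩ := hPneg.dichotomy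
    exact bijOn_bordered_difference (hneg.trans hpos) (hA.bounded p) hK hα hα1 (hP p)
      hK' hα' hα1' (hR p)
  have hF : ∀ p, (differenceOperator hA p).IsFredholm := fun p =>
    isFredholm_of_bijOn_border _ (singleAt d (κpos - 1)) (evalAt d κpos) (evalAt d κneg)
      (Ppos p κpos) (Q p) (hbij p)
  have key : ∀ (V : Submodule ℝ (EllZero d)) (hV : IsTransversal (differenceOperator hA) V),
      indexClass (differenceOperator hA) hc hF V hV =
        (hPpos.imageBundle (n := κpos) Set.self_mem_Ici).koClass -
          (hPneg.imageBundle (n := κneg) Set.self_mem_Iic).koClass := by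
    intro V hV
    have := hV.finite
    have h1 := koClass_preimageBundle_add (differenceOperator hA) hc hF V hV
      (singleAt d (κpos - 1)) (evalAt d κpos) (evalAt d κneg) (fun p => Ppos p κpos)
      (hPpos.continuous κpos self_mem_Ici) (hPpos.projector self_mem_Ici) Q hQc hQP hbij
    have h2 := koClass_imageBundle_compl (fun p => Pneg p κneg) Q hPnegc hQc hPnegP hQP
      fun p x => add_sub_cancel _ _
    change (preimageBundle (differenceOperator hA) hc hF V hV).koClass -
      (RealVectorBundle.trivial Λ V).koClass = (imageBundle (fun p => Ppos p κpos) _ _).koClass -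
        (imageBundle (fun p => Pneg p κneg) hPnegc hPnegP).koClass
    rw [← h2] at h1
    rw [sub_eq_sub_iff_add_eq_add]
    refine add_right_cancel (b := (imageBundle Q hQc hQP).koClass) ?_
    rw [add_assoc, h1]
    abel
  exact ⟨hc, hF, key _ _, key⟩
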